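/- **Setting.** Fix numbers $k$ of players, $W$ of wires and $n\ge 0$ of trap qubits. Every wire is an input wire of one player or an ancilla, and an output wire of one player or discarded. Let $C$ be a quantum circuit on the $W$ wires, made of single-qubit Clifford gates, $\mathsf{CNOT}$ and $\mathsf T$ gates (each possibly classically controlled by an earlier measurement outcome) and destructive computational-basis measurements. Let $I_{\mathcal A}\subsetneq[k]$ be the set of corrupted players. Let $\mathscr C_{N}$ be the $N$-qubit Clifford group (the normaliser of the Pauli group in the unitary group), taken modulo global phases when its elements are used as keys. *Ideal functionality $\mathfrak I^{C}$.* All players send their input wires to a trusted third party, who sets the ancillas to $|0\rangle$ and applies $C$. For every output wire $v$ it samples an independent uniform key $E_v\in\mathscr C_{n+1}$, applies $\rho\mapsto E_v(\rho\otimes|0^n\rangle\langle 0^n|)E_v^\dagger$ to that wire, and sends the result to the owner of $v$. Then each corrupted player sends a bit. If all bits are $0$, all keys and all measurement outcomes are stored in the state register $S$; otherwise $\bot$ is stored in $S$. *Subprotocol $\Pi^{G^{m_\ell}}$.* Let $G$ be a single-qubit Clifford, $w$ an output wire of some player that $C$ leaves unmeasured, and $m_\ell$ the outcome of a measurement made in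 $C$ (or $m_\ell=1$ for an unconditional gate). An ideal classical multi-party computation with abort, whose internal state is $S$, is called once, without inputs from or outputs to the players: it replaces the stored key $E_w$ by $E_w\big((G^{m_\ell})^\dagger\otimes I^{\otimes n}\big)$ and leaves the rest of $S$ unchanged (if $S=\bot$ it stays $\bot$). Corrupted players respond with bits; if some bit is $1$, $S$ is overwritten with $\bot$. Write $\Pi^{G^{m_\ell}}\diamond\mathfrak I^C$ for $\mathfrak I^C$ followed by $\Pi^{G^{m_\ell}}$, and $G^{m_\ell}\circ C$ for $C$ followed by the (controlled) gate $G$ on wire $w$. *Adversaries, simulators, environments.* An adversary $\mathcal A$ on $\Pi^{G^{m_\ell}}\diamond\mathfrak I^C$ plays all corrupted players jointly: it receives their inputs and a side-information register, computes what is submitted to $\mathfrak I^C$; receives the encoded outputs of the corrupted players and computes the bits for $\mathfrak I^C$; then computes the bits for $\Pi^{G^{m_\ell}}$ and its final output (encoded-output registers of the corrupted players and a side-information register). A simulator $\mathcal S$ plays the same role in $\mathfrak I^{G^{m_\ell}\circ C}$, where there is only one round of bits. Both are given by quantum circuits (ancillas in state $|0\rangle$, gates, discarding of qubits) over a common gate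 set $\mathcal G$, which may be any set of unitary gates containing $\mathsf{NOT}$ and the Toffoli gate, in particular the set of all unitary gates. The size of a circuit is its number of gates plus its number of qubits, and the complexity of $\mathcal A$ or $\mathcal S$ is the total size of its circuits. An environment $\mathcal E$ prepares an arbitrary joint state of all players' inputs, the side information and a private register, and at the end outputs a bit by an arbitrary two-outcome measurement on its private register, all players' outputs, the side information and the state register $S$. **Lemma.** There is a polynomial $p$ such that for all data as above (all $\mathcal G$, $k$, $W$, $n$, partitions of the wires, $C$, $G$, $w$, $m_\ell$, $I_{\mathcal A}\subsetneq[k]$) and every adversary $\mathcal A$ on $\Pi^{G^{m_\ell}}\diamond\mathfrak I^C$, there is a simulator $\mathcal S$ of complexity at most $p(\text{complexity of }\mathcal A)$ such that for all environments $\mathcal E$ $$\Pr\big[1\leftarrow(\mathcal E\leftrightarrows(\Pi^{G^{m_\ell}}\diamond\mathfrak I^{C})_{\mathcal A})\big]=\Pr\big[1\leftarrow(\mathcal E\leftrightarrows\mathfrak I^{G^{m_\ell}\circ C}_{\mathcal S})\big].$$ -/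

import Mathlib

open scoped Matrix ComplexOrder

noncomputable section

namespace MPQC

/-! ### Qubit registers -/

/-- Labels of the computational basis of a register whose qubits are indexed by `ι`.
A (possibly subnormalised) state of the register is a matrix indexed by these labels. -/
abbrev Reg (ι : Type) : Type := ι → Bool

/-- The square complex matrices indexed by `a`: operators on the Hilbert space with basis `a`. -/
abbrev Op (a : Type) : Type := Matrix a a ℂ

/-- The operator `A` on the wires `f 0, …, f (m-1)`, tensored with `⊗ i, Q i` on all other wires. -/
def mixOp {ι : Type} [Fintype ι] [DecidableEq ι] {m : ℕ} (f : Fin m ↪ ι)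
    (A : Op (Reg (Fin m))) (Q : ι → Op Bool) : Op (Reg ι) :=
  Matrix.of fun x y => A (x ∘ f) (y ∘ f) *
    ∏ i : {i : ι // i ∉ Set.range f}, Q i.1 (x i.1) (y i.1)

/-- The operator `A` on the wires `f 0, …, f (m-1)`, tensored with the identity elsewhere. -/
def embedOp {ι : Type} [Fintype ι] [DecidableEq ι] {m : ℕ} (f : Fin m ↪ ι)
    (A : Op (Reg (Fin m))) : Op (Reg ι) :=
  mixOp f A (fun _ => 1)

/-- The single wire `w`, as a one-element selection of wires. -/
def oneWire {ι : Type} (w : ι) : Fin 1 ↪ ι := ⟨fun _ => w, fun _ _ _ => Subsingleton.elim _ _⟩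

/-- Two distinct wires, as a selection of wires. -/
def twoWires {ι : Type} (c t : ι) (h : c ≠ t) : Fin 2 ↪ ι :=
  ⟨![c, t], by
    intro i j hij
    fin_cases i <;> fin_cases j <;> simp_all⟩

/-- Adjoin to a state on the qubits `α` all other qubits of `ι`, in the state `|0⟩`. -/
def addZeros {α ι : Type} [Fintype ι] [DecidableEq ι] [Fintype α] (f : α ↪ ι)
    (ρ : Op (Reg α)) : Op (Reg ι) :=
  open Classical in
  Matrix.of fun x y =>
    if ∀ q, q ∉ Set.range f → x q = false ∧ y q = false then ρ (x ∘ f) (y ∘ f) else 0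

/-- Partial trace: keep the qubits `f b`, `b : β`, and discard all other qubits of `ι`. -/
def keep {β ι : Type} [Fintype ι] [DecidableEq ι] (f : β ↪ ι) (σ : Op (Reg ι)) : Op (Reg β) :=
  open Classical in
  Matrix.of fun u v => ∑ x : Reg ι, ∑ y : Reg ι,
    if x ∘ f = u ∧ y ∘ f = v ∧ ∀ q, q ∉ Set.range f → x q = y q then σ x y else 0

/-- Apply a map on states of a register to the first of two registers. -/
def onFst {a b c : Type} (Φ : Op a → Op b) (ρ : Op (a × c)) : Op (b × c) :=
  Matrix.of fun p q => Φ (Matrix.of fun i j => ρ (i, p.2) (j, q.2)) p.1 q.1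

/-! ### Pauli and Clifford groups -/

/-- The unitary group of the register with qubits `ι`. -/
abbrev U (ι : Type) [Fintype ι] [DecidableEq ι] : Type := Matrix.unitaryGroup (Reg ι) ℂ

/-- The Pauli operator `X`. -/
def pauliX : Op Bool := Matrix.of fun i j => if i = j then 0 else 1

/-- The Pauli operator `Z`. -/
def pauliZ : Op Bool := Matrix.diagonal fun b => if b then -1 else 1

/-- The single-qubit operator `X ^ a * Z ^ b`. -/
def pauliXZ (a b : Bool) : Op Bool := (if a then pauliX else 1) * (if b then pauliZ else 1)

/-- The tensor product of single-qubit operators. -/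
def tensorOp {ι : Type} [Fintype ι] (Q : ι → Op Bool) : Op (Reg ι) :=
  Matrix.of fun x y => ∏ i, Q i (x i) (y i)

/-- The `N`-qubit Pauli group (as a set of unitaries): `i ^ j • ⨂ q, X ^ (a q) * Z ^ (b q)`. -/
def pauliGroup (N : ℕ) : Set (U (Fin N)) :=
  {P | ∃ (j : Fin 4) (a b : Reg (Fin N)),
    (P : Op (Reg (Fin N))) = Complex.I ^ (j : ℕ) • tensorOp fun q => pauliXZ (a q) (b q)}

/-- The `N`-qubit Clifford group: the normaliser of the Pauli group in the unitary group. -/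
def cliffordGroup (N : ℕ) : Subgroup (U (Fin N)) := Subgroup.normalizer (pauliGroup N)

/-- The global phases in the Clifford group. -/
def phases (N : ℕ) : Subgroup (cliffordGroup N) where
  carrier := {g | ∃ c : ℂ, (g.1 : Op (Reg (Fin N))) = c • 1}
  one_mem' := ⟨1, by simp⟩
  mul_mem' := by
    rintro a b ⟨c, hc⟩ ⟨d, hd⟩
    exact ⟨c * d, by simp [hc, hd, smul_smul, mul_comm]⟩
  inv_mem' := by
    rintro a ⟨c, hc⟩
    refine ⟨star c, ?_⟩
    rw [Subgroup.coe_inv, Matrix.UnitaryGroup.inv_val, hc]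
    simp

instance phases_normal (N : ℕ) : (phases N).Normal where
  conj_mem := by
    rintro a ⟨c, hc⟩ g
    refine ⟨c, ?_⟩
    have h : (g.1 : Op (Reg (Fin N))) * star (g.1 : Op (Reg (Fin N))) = 1 :=
      Matrix.mem_unitaryGroup_iff.mp g.1.2
    simp [hc, h]

/-- A key of the Clifford code: a Clifford operator, up to a global phase. -/
abbrev CliffordKey (N : ℕ) : Type := cliffordGroup N ⧸ phases N

theorem pauliGroup_finite (N : ℕ) : (pauliGroup N).Finite := by
  have h : (Set.range fun t : Fin 4 × Reg (Fin N) × Reg (Fin N) =>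
      (Complex.I ^ (t.1 : ℕ) • tensorOp fun q => pauliXZ (t.2.1 q) (t.2.2 q) :
        Op (Reg (Fin N)))).Finite := Set.finite_range _
  refine Set.Finite.of_finite_image (f := Subtype.val) (h.subset ?_) Subtype.val_injective.injOn
  rintro _ ⟨P, ⟨j, a, b, hP⟩, rfl⟩
  exact ⟨(j, a, b), hP.symm⟩

theorem tensorOp_mul {ι : Type} [Fintype ι] [DecidableEq ι] (Q R : ι → Op Bool) :
    tensorOp Q * tensorOp R = tensorOp fun i => Q i * R i := by
  ext x y
  simp only [tensorOp, Matrix.mul_apply, Matrix.of_apply, ← Finset.prod_mul_distrib]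
  rw [Finset.prod_univ_sum, Fintype.piFinset_univ]

theorem tensorOp_one {ι : Type} [Fintype ι] [DecidableEq ι] :
    tensorOp (fun _ : ι => (1 : Op Bool)) = 1 := by
  ext x y
  simp only [tensorOp, Matrix.of_apply, Matrix.one_apply]
  by_cases h : x = y
  · simp [h]
  · obtain ⟨i, hi⟩ := Function.ne_iff.mp h
    rw [if_neg h]
    exact Finset.prod_eq_zero (Finset.mem_univ i) (by simp [hi])

theorem pauliXZ_apply (a b x y : Bool) :
    pauliXZ a b x y = if x = xor a y then (if b && y then -1 else 1) else 0 := by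
  cases a <;> cases b <;> cases x <;> cases y <;>
    simp [pauliXZ, pauliX, pauliZ, Matrix.mul_apply, Matrix.one_apply]

theorem pauliXZ_mul_conjTranspose (a b : Bool) :
    pauliXZ a b * (pauliXZ a b)ᴴ = 1 := by
  ext x y
  cases a <;> cases b <;> cases x <;> cases y <;>
    simp [Matrix.mul_apply, pauliXZ_apply]

theorem tensorOp_mem_unitary {N : ℕ} (a b : Reg (Fin N)) :
    (tensorOp fun q => pauliXZ (a q) (b q)) ∈ Matrix.unitaryGroup (Reg (Fin N)) ℂ := by
  rw [Matrix.mem_unitaryGroup_iff]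
  have h : star (tensorOp fun q => pauliXZ (a q) (b q)) =
      tensorOp fun q => (pauliXZ (a q) (b q))ᴴ := by
    ext x y
    simp [tensorOp, Matrix.star_apply, Matrix.conjTranspose_apply]
  rw [h, tensorOp_mul]
  simp only [pauliXZ_mul_conjTranspose]
  exact tensorOp_one

/-- An operator that commutes with all Pauli operators is a scalar. -/
theorem scalar_of_commute {N : ℕ} (A : Op (Reg (Fin N)))
    (h : ∀ a b : Reg (Fin N), A * (tensorOp fun q => pauliXZ (a q) (b q)) =
      (tensorOp fun q => pauliXZ (a q) (b q)) * A) :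
    ∃ c : ℂ, A = c • 1 := by
  have entry : ∀ (a b x y : Reg (Fin N)), (tensorOp fun q => pauliXZ (a q) (b q)) x y =
      if x = (fun q => xor (a q) (y q)) then ∏ q, (if b q && y q then (-1 : ℂ) else 1) else 0 := by
    intro a b x y
    simp only [tensorOp, Matrix.of_apply, pauliXZ_apply]
    by_cases hx : x = fun q => xor (a q) (y q)
    · subst hx; simp
    · obtain ⟨i, hi⟩ := Function.ne_iff.mp hx
      rw [if_neg hx]
      exact Finset.prod_eq_zero (Finset.mem_univ i) (by simp [hi])
  have left : ∀ a b x y : Reg (Fin N), (A * (tensorOp fun q => pauliXZ (a q) (b q))) x y =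
      A x (fun q => xor (a q) (y q)) * ∏ q, (if b q && y q then (-1 : ℂ) else 1) := by
    intro a b x y
    simp [Matrix.mul_apply, entry]
  have right : ∀ a b x y : Reg (Fin N), ((tensorOp fun q => pauliXZ (a q) (b q)) * A) x y =
      (∏ q, (if b q && xor (a q) (x q) then (-1 : ℂ) else 1)) * A (fun q => xor (a q) (x q)) y := by
    intro a b x y
    rw [Matrix.mul_apply, Finset.sum_eq_single (fun q => xor (a q) (x q))]
    · rw [entry, if_pos (by funext q; simp)]
    · intro z _ hz
      rw [entry, if_neg, zero_mul]
      rintro rfl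
      exact hz (by funext q; simp)
    · simp
  have key : ∀ a b x y : Reg (Fin N),
      A x (fun q => xor (a q) (y q)) * ∏ q, (if b q && y q then (-1 : ℂ) else 1) =
      (∏ q, (if b q && xor (a q) (x q) then (-1 : ℂ) else 1)) *
        A (fun q => xor (a q) (x q)) y := by
    intro a b x y
    rw [← left, h, right]
  have off : ∀ x y, x ≠ y → A x y = 0 := by
    intro x y hxy
    obtain ⟨i, hi⟩ := Function.ne_iff.mp hxy
    have e := key (fun _ => false) (fun q => decide (q = i)) x y
    have s : ∀ z : Reg (Fin N), (∏ q, (if decide (q = i) && z q then (-1 : ℂ) else 1)) =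
        if z i then -1 else 1 := by
      intro z
      rw [Finset.prod_eq_single i]
      · simp
      · intro q _ hq; simp [hq]
      · simp
    simp only [Bool.false_xor] at e
    rw [s, s] at e
    cases hx : x i <;> cases hy : y i
    · exact absurd (hx.trans hy.symm) hi
    · simp [hx, hy] at e
      linear_combination (-1 / 2 : ℂ) * e
    · simp [hx, hy] at e
      linear_combination (1 / 2 : ℂ) * e
    · exact absurd (hx.trans hy.symm) hi
  refine ⟨A (fun _ => false) (fun _ => false), ?_⟩
  ext x y
  by_cases hxy : x = y
  · subst hxy
    have e := key x (fun _ => false) x (fun _ => false)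
    simp at e
    simp [e]
  · simp [off x y hxy, hxy]

instance cliffordKey_finite (N : ℕ) : Finite (CliffordKey N) := by
  have hfin : Finite (pauliGroup N) := (pauliGroup_finite N).to_subtype
  let φ : CliffordKey N → (pauliGroup N → pauliGroup N) := fun q P =>
    ⟨(Quotient.out q).1 * P.1 * (Quotient.out q).1⁻¹,
      ((Subgroup.mem_set_normalizer_iff.mp (Quotient.out q).2) P.1).mp P.2⟩
  refine Finite.of_injective φ ?_
  intro q q' hq
  rw [← Quotient.out_eq q, ← Quotient.out_eq q']
  refine (QuotientGroup.eq (s := phases N)).mpr ?_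
  refine scalar_of_commute _ ?_
  intro a b
  let P : U (Fin N) := ⟨_, tensorOp_mem_unitary a b⟩
  have hmem : P ∈ pauliGroup N := ⟨0, a, b, by simp [P]⟩
  have e : (Quotient.out q).1 * P * (Quotient.out q).1⁻¹ =
      (Quotient.out q').1 * P * (Quotient.out q').1⁻¹ :=
    congrArg Subtype.val (congrFun hq ⟨P, hmem⟩)
  have e' : (Quotient.out q).1⁻¹ * (Quotient.out q').1 * P =
      P * ((Quotient.out q).1⁻¹ * (Quotient.out q').1) := by
    have := congrArg (fun T => (Quotient.out q).1⁻¹ * T * (Quotient.out q').1) e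
    simpa [mul_assoc] using this.symm
  exact congrArg Subtype.val e'

instance cliffordKey_fintype (N : ℕ) : Fintype (CliffordKey N) := Fintype.ofFinite _

instance cliffordKey_decidableEq (N : ℕ) : DecidableEq (CliffordKey N) := Classical.decEq _

/-! ### Applying a Clifford operator to some of the qubits -/

theorem mixOp_mul {ι : Type} [Fintype ι] [DecidableEq ι] {m : ℕ} (f : Fin m ↪ ι)
    (A B : Op (Reg (Fin m))) (Q R : ι → Op Bool) :
    mixOp f A Q * mixOp f B R = mixOp f (A * B) (fun i => Q i * R i) := by
  classical
  let e : Reg ι ≃ Reg (Fin m) × Reg {i : ι // i ∉ Set.range f} :=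
    (Equiv.piEquivPiSubtypeProd (fun i => i ∈ Set.range f) (fun _ => Bool)).trans
      (Equiv.prodCongr (Equiv.arrowCongr (Equiv.ofInjective f f.injective).symm (Equiv.refl _))
        (Equiv.refl _))
  ext x y
  simp only [Matrix.mul_apply, mixOp, Matrix.of_apply]
  rw [Finset.prod_univ_sum, Fintype.piFinset_univ, Finset.sum_mul_sum, ← Fintype.sum_prod_type']
  refine Fintype.sum_equiv e _ _ fun z => ?_
  have h1 : (e z).1 = z ∘ f := by
    funext j
    simp [e, Equiv.piEquivPiSubtypeProd, Equiv.arrowCongr]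
  have h2 : ∀ i, (e z).2 i = z i.1 := fun i => rfl
  simp only [h1, h2, Finset.prod_mul_distrib]
  ring

theorem mixOp_tensor {ι : Type} [Fintype ι] [DecidableEq ι] {m : ℕ} (f : Fin m ↪ ι)
    (Q : ι → Op Bool) : mixOp f (tensorOp fun j => Q (f j)) Q = tensorOp Q := by
  classical
  ext x y
  simp only [mixOp, tensorOp, Matrix.of_apply, Function.comp]
  have h : ∏ j, Q (f j) (x (f j)) (y (f j)) =
      ∏ i : {i // i ∈ Set.range f}, Q i.1 (x i.1) (y i.1) :=
    Fintype.prod_equiv (Equiv.ofInjective f f.injective)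
      (fun j => Q (f j) (x (f j)) (y (f j)))
      (fun i : {i // i ∈ Set.range f} => Q i.1 (x i.1) (y i.1)) fun j => rfl
  rw [h]
  convert Fintype.prod_subtype_mul_prod_subtype (fun i => i ∈ Set.range f)
    (fun i => Q i (x i) (y i))

theorem mixOp_star {ι : Type} [Fintype ι] [DecidableEq ι] {m : ℕ} (f : Fin m ↪ ι)
    (A : Op (Reg (Fin m))) (Q : ι → Op Bool) :
    star (mixOp f A Q) = mixOp f (star A) (fun i => star (Q i)) := by
  ext x y
  simp [mixOp, Matrix.star_apply]

theorem mixOp_one {ι : Type} [Fintype ι] [DecidableEq ι] {m : ℕ} (f : Fin m ↪ ι) :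
    mixOp f 1 (fun _ => 1) = 1 := by
  rw [← tensorOp_one (ι := Fin m), ← tensorOp_one (ι := ι)]
  exact mixOp_tensor f fun _ => 1

/-- `embedOp` on unitaries, as a group homomorphism. -/
def embedU {ι : Type} [Fintype ι] [DecidableEq ι] {m : ℕ} (f : Fin m ↪ ι) : U (Fin m) →* U ι where
  toFun A := ⟨embedOp f A.1, by
    rw [Matrix.mem_unitaryGroup_iff, embedOp, mixOp_star, mixOp_mul,
      Matrix.mem_unitaryGroup_iff.mp A.2]
    simpa using mixOp_one f⟩
  map_one' := Subtype.ext (mixOp_one f)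
  map_mul' A B := Subtype.ext (by
    change embedOp f (A.1 * B.1) = embedOp f A.1 * embedOp f B.1
    simp [embedOp, mixOp_mul])

theorem embedU_conj_mem {N m : ℕ} (f : Fin m ↪ Fin N) {A : U (Fin m)}
    (hA : A ∈ cliffordGroup m) {P : U (Fin N)} (hP : P ∈ pauliGroup N) :
    embedU f A * P * (embedU f A)⁻¹ ∈ pauliGroup N := by
  classical
  obtain ⟨j, a, b, hP⟩ := hP
  let P' : U (Fin m) := ⟨_, tensorOp_mem_unitary (a ∘ f) (b ∘ f)⟩
  have hP' : P' ∈ pauliGroup m := ⟨0, a ∘ f, b ∘ f, by simp [P']⟩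
  obtain ⟨j', a', b', h'⟩ := (Subgroup.mem_set_normalizer_iff.mp hA P').mp hP'
  let ext : Reg (Fin m) → Reg (Fin N) → Reg (Fin N) := fun u v => Function.extend f u v
  have hon : ∀ u v i, ext u v (f i) = u i := fun u v i => f.injective.extend_apply _ _ _
  have hoff : ∀ u v q, q ∉ Set.range f → ext u v q = v q := fun u v q hq =>
    Function.extend_apply' _ _ _ hq
  refine ⟨Fin.ofNat 4 (j + j'), ext a' a, ext b' b, ?_⟩
  have hI : Complex.I ^ ((Fin.ofNat 4 ((j : ℕ) + j') : Fin 4) : ℕ) =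
      Complex.I ^ (j : ℕ) * Complex.I ^ (j' : ℕ) := by
    rw [← pow_add]
    simp only [Fin.ofNat]
    conv_rhs => rw [← Nat.div_add_mod ((j : ℕ) + j') 4, pow_add, pow_mul, Complex.I_pow_four]
    simp
  have hinv : (((embedU f A)⁻¹ : U (Fin N)) : Op (Reg (Fin N))) = embedOp f (star A.1) := by
    rw [← map_inv]
    rfl
  change embedOp f A.1 * P.1 * (((embedU f A)⁻¹ : U (Fin N)) : Op (Reg (Fin N))) = _
  rw [hinv, hP, ← mixOp_tensor f, ← mixOp_tensor f fun q => pauliXZ (ext a' a q) (ext b' b q)]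
  simp only [hon]
  have h'' : A.1 * (tensorOp fun i => pauliXZ (a (f i)) (b (f i))) * star A.1 =
      Complex.I ^ (j' : ℕ) • tensorOp fun q => pauliXZ (a' q) (b' q) := h'
  simp only [embedOp, Matrix.mul_smul, Matrix.smul_mul, mixOp_mul, one_mul, mul_one]
  rw [h'', hI]
  ext x y
  simp only [mixOp, Matrix.smul_apply, Matrix.of_apply, smul_eq_mul]
  rw [Finset.prod_congr rfl (fun (q : {i // i ∉ Set.range f}) _ =>
    show pauliXZ (ext a' a q.1) (ext b' b q.1) (x q.1) (y q.1) =
      pauliXZ (a q.1) (b q.1) (x q.1) (y q.1) by rw [hoff _ _ _ q.2, hoff _ _ _ q.2])]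
  ring

/-- A Clifford operator on some of the qubits, as a Clifford operator on all qubits. -/
def embedClifford {N m : ℕ} (f : Fin m ↪ Fin N) (A : cliffordGroup m) : cliffordGroup N :=
  ⟨embedU f A.1, by
    rw [cliffordGroup, Subgroup.mem_set_normalizer_iff]
    intro P
    refine ⟨embedU_conj_mem f A.2, fun h => ?_⟩
    have h2 := embedU_conj_mem f (A⁻¹).2 h
    simpa [mul_assoc] using h2⟩

/-! ### Quantum circuits computed by the functionality -/

/-- The gate `CNOT`: qubit `0` controls, qubit `1` is the target. -/
def cnotOp : Op (Reg (Fin 2)) :=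
  Matrix.of fun x y => if x 0 = y 0 ∧ x 1 = xor (y 1) (y 0) then 1 else 0

/-- The gate `T`. -/
def tOp : Op (Reg (Fin 1)) :=
  Matrix.diagonal fun x => if x 0 then Complex.exp (Complex.I * Real.pi / 4) else 1

/-- Circuits on `W` wires made of single-qubit Cliffords, `CNOT` and `T` gates, each of which may be
classically controlled by an earlier measurement outcome, and of destructive computational-basis
measurements. The index is the set of wires that have been measured: a measured wire is
classical from then on, no gate acts on it, and its value may be used as a control. -/
inductive Circuit (W : ℕ) : Finset (Fin W) → Type
  | empty : Circuit W ∅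
  | clifford {M : Finset (Fin W)} (C : Circuit W M) (G : cliffordGroup 1) (w : Fin W)
      (hw : w ∉ M) (ctrl : Option {l : Fin W // l ∈ M}) : Circuit W M
  | cnot {M : Finset (Fin W)} (C : Circuit W M) (c t : Fin W) (hct : c ≠ t)
      (hc : c ∉ M) (ht : t ∉ M) (ctrl : Option {l : Fin W // l ∈ M}) : Circuit W M
  | tGate {M : Finset (Fin W)} (C : Circuit W M) (w : Fin W)
      (hw : w ∉ M) (ctrl : Option {l : Fin W // l ∈ M}) : Circuit W M
  | measure {M : Finset (Fin W)} (C : Circuit W M) (w : Fin W) (hw : w ∉ M) :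
      Circuit W (insert w M)

/-- Whether a gate is to be applied, given the measurement outcomes: always if the gate is
unconditional (`none`), and iff `m ℓ = 1` if it is controlled by `m ℓ`. -/
def fires {W : ℕ} {M : Finset (Fin W)} (ctrl : Option {l : Fin W // l ∈ M})
    (m : {l : Fin W // l ∈ M} → Bool) : Bool :=
  ctrl.elim true m

/-- Conjugate `σ` by the operator `A`, classically controlled by wires in `M`. -/
def applyCtrl {W : ℕ} {M : Finset (Fin W)} (ctrl : Option {l : Fin W // l ∈ M})
    (A : Op (Reg (Fin W))) (σ : Op (Reg (Fin W))) : Op (Reg (Fin W)) :=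
  let V : Op (Reg (Fin W)) := Matrix.of fun x y =>
    if fires ctrl (fun l => x l.1) then A x y else (1 : Op (Reg (Fin W))) x y
  V * σ * Vᴴ

/-- The state transformation of a circuit. Measuring a wire makes it classical, that is, it removes
the off-diagonal terms of that wire. -/
def Circuit.run {W : ℕ} : {M : Finset (Fin W)} → Circuit W M → Op (Reg (Fin W)) → Op (Reg (Fin W))
  | _, .empty, σ => σ
  | _, .clifford C G w _ ctrl, σ =>
      applyCtrl ctrl (embedOp (oneWire w) G.1.1) (C.run σ)
  | _, .cnot C c t hct _ _ ctrl, σ =>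
      applyCtrl ctrl (embedOp (twoWires c t hct) cnotOp) (C.run σ)
  | _, .tGate C w _ ctrl, σ =>
      applyCtrl ctrl (embedOp (oneWire w) tOp) (C.run σ)
  | _, .measure C w _, σ =>
      Matrix.of fun x y => if x w = y w then C.run σ x y else 0

/-! ### The setting and the ideal functionality -/

/-- The data of a `k`-party computation on `W` wires: every wire is an input wire of a player
or an ancilla (`none`), and an output wire of a player or discarded (`none`). -/
structure Setting where
  /-- the number `k` of players -/
  k : ℕ
  /-- the number `W` of wires -/
  W : ℕ
  /-- the number `n` of trap qubits of the Clifford code -/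
  n : ℕ
  inOwner : Fin W → Option (Fin k)
  outOwner : Fin W → Option (Fin k)
  /-- the set of corrupted players -/
  corrupt : Finset (Fin k)
  corrupt_proper : corrupt ⊂ Finset.univ
  /-- the number of qubits of side information that the adversary receives -/
  sideIn : ℕ
  /-- the number of qubits of side information that the adversary outputs -/
  sideOut : ℕ

namespace Setting

variable (P : Setting)

/-- The input wires of all players. -/
abbrev InWire : Type := {w : Fin P.W // P.inOwner w ≠ none}

/-- The output wires of all players. -/
abbrev OutWire : Type := {w : Fin P.W // P.outOwner w ≠ none}

/-- The corrupted players. -/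
abbrev Corrupted : Type := {i : Fin P.k // i ∈ P.corrupt}

/-- The input wires of corrupted players. -/
abbrev AdvIn : Type := {w : P.InWire // ∃ i ∈ P.corrupt, P.inOwner w.1 = some i}

/-- The input wires of honest players. -/
abbrev HonIn : Type := {w : P.InWire // ¬ ∃ i ∈ P.corrupt, P.inOwner w.1 = some i}

/-- The output wires of corrupted players. -/
abbrev AdvOut : Type := {w : P.OutWire // ∃ i ∈ P.corrupt, P.outOwner w.1 = some i}

/-- The output wires of honest players. -/
abbrev HonOut : Type := {w : P.OutWire // ¬ ∃ i ∈ P.corrupt, P.outOwner w.1 = some i}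

/-- The Clifford keys of all output wires. -/
abbrev Keys : Type := P.OutWire → CliffordKey (P.n + 1)

/-- What the functionality stores if nobody aborts: all keys and all measurement outcomes. -/
abbrev Record (M : Finset (Fin P.W)) : Type := P.Keys × ({l : Fin P.W // l ∈ M} → Bool)

/-- The contents of the state register `S`: a record, or `⊥` (that is, `none`) after an abort. -/
abbrev Store (M : Finset (Fin P.W)) : Type := Option (P.Record M)

end Setting

variable {P : Setting} {M : Finset (Fin P.W)}

/-- The isometry `|ψ⟩ ↦ E (|ψ⟩ ⊗ |0ⁿ⟩)` of the Clifford code with key `E` (for any choice of the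
global phase of `E`); qubit `0` of the code word is the data qubit. -/
def encodeOp {n : ℕ} (E : CliffordKey (n + 1)) : Matrix (Reg (Fin (n + 1))) Bool ℂ :=
  Matrix.of fun y b => (Quotient.out E).1.1 y (Fin.cons b fun _ => false)

/-- The tensor product of the encoding isometries of all output wires. -/
def encodeAllOp (E : P.Keys) : Matrix (Reg (P.OutWire × Fin (P.n + 1))) (Reg P.OutWire) ℂ :=
  Matrix.of fun y x => ∏ w, encodeOp (E w) (fun j => y (w, j)) (x w)

/-- The part of a state in which the measured wires have the values `m`. -/
def outcomePart (m : {l : Fin P.W // l ∈ M} → Bool) (σ : Op (Reg (Fin P.W))) :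
    Op (Reg (Fin P.W)) :=
  Matrix.of fun x y => if ∀ l, x l.1 = m l ∧ y l.1 = m l then σ x y else 0

/-- The first part of the ideal functionality for `C`, as a family of completely positive maps
indexed by the keys and the measurement outcomes: take all inputs, set the ancillas to `|0⟩`,
apply `C`, discard the wires that are nobody's output, and encode every output wire with an
independent uniformly random Clifford. The map for `(E, m)` is weighted by the probability of the
keys `E`, and its output by the probability of the outcomes `m`. -/
def functionality (C : Circuit P.W M) (s : P.Record M) (ρ : Op (Reg P.InWire)) :
    Op (Reg (P.OutWire × Fin (P.n + 1))) :=
  let σ : Op (Reg (Fin P.W)) := C.run (addZeros (Function.Embedding.subtype _) ρ)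
  let τ : Op (Reg P.OutWire) := keep (Function.Embedding.subtype _) (outcomePart s.2 σ)
  (Fintype.card P.Keys : ℂ)⁻¹ • (encodeAllOp s.1 * τ * (encodeAllOp s.1)ᴴ)

/-- The last part of the ideal functionality: given the bits of the corrupted players, the record is
stored if all bits are `0`, and `⊥` is stored otherwise. -/
def storeUnlessAbort (b : P.Corrupted → Bool) (s : P.Record M) : P.Store M :=
  if ∀ i, b i = false then some s else none

/-- A call to the ideal classical multi-party computation with abort, in which no player has an input
or an output and the internal state is updated with the function `f`. Corrupted players
respond with bits; if a bit is `1`, the state register is overwritten with `⊥`. -/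
def mpcCall (f : P.Record M → P.Record M) (b : P.Corrupted → Bool) (s : P.Store M) : P.Store M :=
  if ∀ i, b i = false then s.map f else none

/-- The key `E ((G ^ m)† ⊗ I^{⊗ n})`, where the bit `m` tells whether `G` is applied. -/
def newKey {n : ℕ} (E : CliffordKey (n + 1)) (G : cliffordGroup 1) (m : Bool) :
    CliffordKey (n + 1) :=
  E * QuotientGroup.mk (embedClifford (oneWire 0) ((if m then G else 1)⁻¹))

/-- The state update of the subprotocol for `G` on the output wire `w`, controlled by `ctrl`. -/
def updateKey (G : cliffordGroup 1) (w : P.OutWire) (ctrl : Option {l : Fin P.W // l ∈ M})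
    (s : P.Record M) : P.Record M :=
  (Function.update s.1 w (newKey (s.1 w) G (fires ctrl s.2)), s.2)

/-! ### Adversaries, simulators and their complexity -/

/-- The classical reversible gate given by a permutation of the basis states. -/
def permGate {m : ℕ} (π : Equiv.Perm (Reg (Fin m))) : U (Fin m) :=
  ⟨Matrix.of fun x y => if x = π y then 1 else 0, by
    rw [Matrix.mem_unitaryGroup_iff']
    ext x y
    simp [Matrix.mul_apply, Matrix.one_apply, Matrix.star_apply, eq_comm]⟩

/-- The gate `NOT`. -/
def notGate : U (Fin 1) :=
  permGate (Function.Involutive.toPerm (fun x q => !(x q)) (by intro x; simp))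

/-- The Toffoli gate. -/
def toffoliGate : U (Fin 3) :=
  permGate (Function.Involutive.toPerm
    (fun x => Function.update x 2 (xor (x 2) (x 0 && x 1))) (by
      intro x; funext q; fin_cases q <;> simp))

/-- A set of elementary unitary gates. -/
abbrev GateSet : Type := Set (Σ m : ℕ, U (Fin m))

/-- A gate of the gate set `𝒢`, placed on some of the qubits `ι`. -/
structure Gate (𝒢 : GateSet) (ι : Type) where
  arity : ℕ
  op : U (Fin arity)
  mem : (⟨arity, op⟩ : Σ m : ℕ, U (Fin m)) ∈ 𝒢
  wires : Fin arity ↪ ι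

/-- A quantum circuit over `𝒢` that turns the qubits `α` into the qubits `β`: adjoin ancillas
in state `|0⟩`, apply gates, output some of the qubits and discard the others. -/
structure PartyCircuit (𝒢 : GateSet) (α β : Type) where
  anc : ℕ
  gates : List (Gate 𝒢 (α ⊕ Fin anc))
  out : β ↪ α ⊕ Fin anc

namespace PartyCircuit

variable {𝒢 : GateSet} {α β : Type} [Fintype α] [DecidableEq α]

/-- The channel of a circuit. -/
def run (K : PartyCircuit 𝒢 α β) (ρ : Op (Reg α)) : Op (Reg β) :=
  keep K.out (K.gates.foldl
    (fun σ g => embedOp g.wires g.op.1 * σ * (embedOp g.wires g.op.1)ᴴ)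
    (addZeros Function.Embedding.inl ρ))

/-- The size of a circuit: the number of its gates and of its qubits. -/
def size (K : PartyCircuit 𝒢 α β) : ℕ := K.gates.length + Fintype.card α + K.anc

end PartyCircuit

/-- The encoded outputs of the corrupted players. -/
abbrev Setting.AdvCode (P : Setting) : Type := P.AdvOut × Fin (P.n + 1)

/-- The encoded outputs of the honest players. -/
abbrev Setting.HonCode (P : Setting) : Type := P.HonOut × Fin (P.n + 1)

/-- A simulator: it plays the corrupted players in the ideal functionality. From the inputs of the
corrupted players and the side information it computes what it submits; from its memory
and the encoded outputs it computes the abort bits and the final outputs. -/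
structure Simulator (𝒢 : GateSet) (P : Setting) where
  mem : ℕ
  first : PartyCircuit 𝒢 (P.AdvIn ⊕ Fin P.sideIn) (P.AdvIn ⊕ Fin mem)
  last : PartyCircuit 𝒢 (Fin mem ⊕ P.AdvCode) (P.Corrupted ⊕ (P.AdvCode ⊕ Fin P.sideOut))

/-- An adversary on an ideal functionality followed by one call to the classical multi-party
computation: it computes what it submits to the functionality, then, from the encoded outputs,
the abort bits for the functionality, and then the abort bits for the call and the final outputs. -/
structure Adversary (𝒢 : GateSet) (P : Setting) where
  mem₁ : ℕ
  mem₂ : ℕ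
  first : PartyCircuit 𝒢 (P.AdvIn ⊕ Fin P.sideIn) (P.AdvIn ⊕ Fin mem₁)
  second : PartyCircuit 𝒢 (Fin mem₁ ⊕ P.AdvCode) (P.Corrupted ⊕ Fin mem₂)
  last : PartyCircuit 𝒢 (Fin mem₂) (P.Corrupted ⊕ (P.AdvCode ⊕ Fin P.sideOut))

variable {𝒢 : GateSet}

/-- The complexity of a simulator. -/
def Simulator.size (S : Simulator 𝒢 P) : ℕ := S.first.size + S.last.size

/-- The complexity of an adversary. -/
def Adversary.size (A : Adversary 𝒢 P) : ℕ := A.first.size + A.second.size + A.last.size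

/-! ### Executions -/

/-- The registers that the environment prepares: a private register of dimension `d`, the inputs of
all players, and the side information. -/
abbrev Setting.EnvIn (P : Setting) (d : ℕ) : Type := Fin d × Reg P.InWire × Reg (Fin P.sideIn)

/-- The quantum registers that the environment finally holds: its private register, the encoded
outputs of all players, and the output side information. -/
abbrev Setting.EnvOut (P : Setting) (d : ℕ) : Type :=
  Fin d × Reg (P.OutWire × Fin (P.n + 1)) × Reg (Fin P.sideOut)

/-- Combine the input wires of corrupted and of honest players. -/
def joinIn (a : Reg P.AdvIn) (h : Reg P.HonIn) : Reg P.InWire := fun w =>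
  if hw : ∃ i ∈ P.corrupt, P.inOwner w.1 = some i then a ⟨w, hw⟩ else h ⟨w, hw⟩

/-- Combine the encoded outputs of corrupted and of honest players. -/
def joinOut (a : Reg P.AdvCode) (h : Reg P.HonCode) : Reg (P.OutWire × Fin (P.n + 1)) := fun w =>
  if hw : ∃ i ∈ P.corrupt, P.outOwner w.1.1 = some i then a (⟨w.1, hw⟩, w.2)
  else h (⟨w.1, hw⟩, w.2)

/-- Relabel the basis of a state. -/
def relabel {a b : Type} (g : b → a) (ρ : Op a) : Op b := ρ.submatrix g g

/-- The state after the first stage of the adversary or simulator and the first part of the functionality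
for `C`, with keys and outcomes `s`. The first register is what the adversary now holds. -/
def afterFunctionality {d mem : ℕ} (C : Circuit P.W M)
    (first : PartyCircuit 𝒢 (P.AdvIn ⊕ Fin P.sideIn) (P.AdvIn ⊕ Fin mem))
    (ρ : Op (P.EnvIn d)) (s : P.Record M) :
    Op (Reg (Fin mem ⊕ P.AdvCode) × (Fin d × Reg P.HonCode)) :=
  let ρ₁ : Op (Reg (P.AdvIn ⊕ Fin P.sideIn) × (Fin d × Reg P.HonIn)) :=
    relabel (fun q => (q.2.1, joinIn (q.1 ∘ Sum.inl) q.2.2, q.1 ∘ Sum.inr)) ρ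
  let ρ₂ : Op (Reg (P.AdvIn ⊕ Fin mem) × (Fin d × Reg P.HonIn)) := onFst first.run ρ₁
  let ρ₃ : Op (Reg P.InWire × (Fin d × Reg (Fin mem))) :=
    relabel (fun q => (Sum.elim (fun w => q.1 w.1) q.2.2, (q.2.1, fun w => q.1 w.1))) ρ₂
  let ρ₄ : Op (Reg (P.OutWire × Fin (P.n + 1)) × (Fin d × Reg (Fin mem))) :=
    onFst (functionality C s) ρ₃
  relabel (fun q => (joinOut (q.1 ∘ Sum.inr) q.2.2, (q.2.1, q.1 ∘ Sum.inl))) ρ₄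

/-- Measure the abort bits; the (subnormalised) state that remains if the outcome is `b`. -/
def measureBits {κ c : Type} (b : P.Corrupted → Bool)
    (ρ : Op (Reg (P.Corrupted ⊕ κ) × c)) : Op (Reg κ × c) :=
  relabel (fun q => (Sum.elim b q.1, q.2)) ρ

/-- Arrange the final registers in the order in which the environment receives them. -/
def deliver {d : ℕ} (ρ : Op (Reg (P.AdvCode ⊕ Fin P.sideOut) × (Fin d × Reg P.HonCode))) :
    Op (P.EnvOut d) :=
  relabel (fun q => (Sum.elim (fun w => q.2.1 (w.1.1, w.2)) q.2.2,
    (q.1, fun w => q.2.1 (w.1.1, w.2)))) ρ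

/-- The joint state of the environment's registers and the state register `S` after the ideal
functionality for `C` with simulator `S`: for each content of the classical register `S`, the
corresponding subnormalised state of the quantum registers. -/
def idealExec {d : ℕ} (C : Circuit P.W M) (S : Simulator 𝒢 P) (ρ : Op (P.EnvIn d)) :
    P.Store M → Op (P.EnvOut d) := fun t =>
  ∑ s : P.Record M, ∑ b : P.Corrupted → Bool,
    if storeUnlessAbort b s = t then
      deliver (measureBits b (onFst S.last.run (afterFunctionality C S.first ρ s)))
    else 0

/-- The same for the ideal functionality for `C`, followed by the subprotocol for the Clifford
`G` on the output wire `w` controlled by `ctrl`, with adversary `A`: the state register of the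
functionality is the internal state of the classical multi-party computation. -/
def protocolExec {d : ℕ} (C : Circuit P.W M) (G : cliffordGroup 1) (w : P.OutWire)
    (ctrl : Option {l : Fin P.W // l ∈ M}) (A : Adversary 𝒢 P) (ρ : Op (P.EnvIn d)) :
    P.Store M → Op (P.EnvOut d) := fun t =>
  ∑ s : P.Record M, ∑ b : P.Corrupted → Bool, ∑ b' : P.Corrupted → Bool,
    if mpcCall (updateKey G w ctrl) b' (storeUnlessAbort b s) = t then
      deliver (measureBits b' (onFst A.last.run
        (measureBits b (onFst A.second.run (afterFunctionality C A.first ρ s)))))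
    else 0

/-- An environment: it prepares a joint state of its private register, all inputs and the side
information, and finally makes a two-outcome measurement on everything it
holds, including the state register `S`. -/
structure Environment (P : Setting) (M : Finset (Fin P.W)) where
  d : ℕ
  state : Op (P.EnvIn d)
  state_pos : state.PosSemidef
  state_trace : state.trace = 1
  effect : P.Store M → Op (P.EnvOut d)
  effect_pos : ∀ t, (effect t).PosSemidef
  effect_le : ∀ t, (1 - effect t).PosSemidef

/-- The probability that the environment outputs `1`, given the final joint state. -/
def Environment.acceptProb (Z : Environment P M) (τ : P.Store M → Op (P.EnvOut Z.d)) : ℝ :=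
  (∑ t, (Z.effect t * τ t).trace).re

end MPQC

end

/-! Write `F` for `G ^ m` acting on the data qubit of the code word of `w`, where `m` is the control
bit. Then `E F⁻¹ (G ^ m ψ ⊗ 0ⁿ) = E (ψ ⊗ 0ⁿ)`: a gate in front of the encoder can be absorbed into
the key. So `C` followed by `G` with key `E F⁻¹` produces the same code words as `C` with key `E`,
and `E F⁻¹` is exactly what the subprotocol stores. `functionality_clifford` states this record by
record. On the branch with outcomes `m` the controlled gate is just `G` or the identity
(`outcomePart_applyCtrl`), and the phases lost by taking keys modulo scalars cancel in the
conjugation. Keys are uniform and `E ↦ E F⁻¹` permutes them (`updateKey_bijective`), so summing over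
all records gives the same state on both sides.

It remains to merge two rounds of abort bits into one. The call returns nothing to the adversary, so
the simulator can run both rounds at once and submit the bitwise disjunction of the bits, computed
with `NOT` and Toffoli gates. The store is `⊥` iff some bit of either round is `1`
(`mpcCall_storeUnlessAbort`), so the disjunction has the same effect. `comp_run` shows that
postponing the discarding of qubits and the reading of the first bits to the end changes nothing,
and `simulator_run` combines this with the disjunction circuit.

The result, `protocolExec_eq_idealExec`, is an equality of joint states for each content of `S`, so
no environment can tell the two executions apart. -/

namespace MPQC

/-! ### Operators on some of the qubits -/

theorem embedOp_apply {ι : Type} [Fintype ι] [DecidableEq ι] {m : ℕ} (f : Fin m ↪ ι)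
    (A : Op (Reg (Fin m))) (x y : Reg ι) [Decidable (∀ i, i ∉ Set.range f → x i = y i)] :
    embedOp f A x y = if ∀ i, i ∉ Set.range f → x i = y i then A (x ∘ f) (y ∘ f) else 0 := by
  simp only [embedOp, mixOp, Matrix.of_apply, Matrix.one_apply]
  split_ifs with h
  · rw [Finset.prod_eq_one, mul_one]
    intro i _
    rw [if_pos (h i.1 i.2)]
  · push Not at h
    obtain ⟨i, hi, hne⟩ := h
    rw [Finset.prod_eq_zero (Finset.mem_univ (⟨i, hi⟩ : {i // i ∉ Set.range f})) (if_neg hne),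
      mul_zero]

/-- The basis label of the register `ι ≃ κ ⊕ κ'` with given labels on `κ` and on `κ'`. -/
def glue {κ κ' ι : Type} (E : κ ⊕ κ' ≃ ι) (u : Reg κ) (z : Reg κ') : Reg ι :=
  Sum.elim u z ∘ E.symm

/-- `glue` as an equivalence. -/
def glueEquiv {κ κ' ι : Type} (E : κ ⊕ κ' ≃ ι) : Reg κ × Reg κ' ≃ Reg ι :=
  (Equiv.sumArrowEquivProdArrow κ κ' Bool).symm.trans (E.arrowCongr (Equiv.refl Bool))

theorem glueEquiv_apply {κ κ' ι : Type} (E : κ ⊕ κ' ≃ ι) (p : Reg κ × Reg κ') :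
    glueEquiv E p = glue E p.1 p.2 := rfl

@[simp] theorem glue_inl {κ κ' ι : Type} (E : κ ⊕ κ' ≃ ι) (u : Reg κ) (z : Reg κ') (i : κ) :
    glue E u z (E (Sum.inl i)) = u i := by simp [glue]

@[simp] theorem glue_inr {κ κ' ι : Type} (E : κ ⊕ κ' ≃ ι) (u : Reg κ) (z : Reg κ') (i : κ') :
    glue E u z (E (Sum.inr i)) = z i := by simp [glue]

/-- The block of an operator with given row and column labels on the qubits `κ'`. -/
def slice {κ κ' ι : Type} (E : κ ⊕ κ' ≃ ι) (z z' : Reg κ') (σ : Op (Reg ι)) : Op (Reg κ) :=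
  Matrix.of fun u v => σ (glue E u z) (glue E v z')

/-- The qubits `κ` of a register `κ ⊕ κ' ≃ ι`. -/
def left {κ κ' ι : Type} (E : κ ⊕ κ' ≃ ι) : κ ↪ ι :=
  Function.Embedding.inl.trans E.toEmbedding

@[simp] theorem left_apply {κ κ' ι : Type} (E : κ ⊕ κ' ≃ ι) (i : κ) :
    left E i = E (Sum.inl i) := rfl

theorem embedOp_glue {κ κ' ι : Type} [Fintype κ] [DecidableEq κ] [Fintype ι] [DecidableEq ι]
    [DecidableEq κ'] (E : κ ⊕ κ' ≃ ι) {m : ℕ} (f : Fin m ↪ κ) (A : Op (Reg (Fin m)))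
    (u v : Reg κ) (z z' : Reg κ') [Decidable (z = z')] :
    embedOp (f.trans (left E)) A (glue E u z) (glue E v z') =
      if z = z' then embedOp f A u v else 0 := by
  classical
  rw [embedOp_apply, embedOp_apply]
  have hf : ∀ (u : Reg κ) (z : Reg κ'), glue E u z ∘ (f.trans (left E)) = u ∘ f := by
    intro u z; funext i; simp
  rw [hf, hf, ← ite_and]
  refine if_congr ?_ rfl rfl
  constructor
  · intro h
    constructor
    · funext i
      simpa using h (E (Sum.inr i)) (by rintro ⟨j, hj⟩; simp at hj)
    · intro i hi
      simpa using h (E (Sum.inl i)) (by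
        rintro ⟨j, hj⟩
        exact hi ⟨j, by simpa using hj⟩)
  · rintro ⟨rfl, h⟩ i hi
    obtain ⟨i, rfl⟩ := E.surjective i
    rcases i with i | i
    · rw [glue_inl, glue_inl]
      exact h i (by rintro ⟨j, rfl⟩; exact hi ⟨j, rfl⟩)
    · simp

/-- The extended operator is block diagonal with the same block everywhere, so conjugation acts on
every block separately, including the off-diagonal ones `z ≠ z'`. -/
theorem slice_conj {κ κ' ι : Type} [Fintype κ] [DecidableEq κ] [Fintype κ'] [Fintype ι]
    [DecidableEq ι] [DecidableEq κ'] (E : κ ⊕ κ' ≃ ι) {m : ℕ} (f : Fin m ↪ κ)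
    (A : Op (Reg (Fin m))) (z z' : Reg κ') (σ : Op (Reg ι)) :
    slice E z z' (embedOp (f.trans (left E)) A * σ * (embedOp (f.trans (left E)) A)ᴴ) =
      embedOp f A * slice E z z' σ * (embedOp f A)ᴴ := by
  classical
  ext u v
  simp only [slice, Matrix.of_apply, Matrix.mul_apply, Matrix.conjTranspose_apply]
  rw [← (glueEquiv E).sum_comp, Fintype.sum_prod_type]
  refine Finset.sum_congr rfl fun x _ => ?_
  rw [Finset.sum_eq_single z']
  · simp only [glueEquiv_apply, embedOp_glue, if_true]
    congr 1
    rw [← (glueEquiv E).sum_comp, Fintype.sum_prod_type]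
    refine Finset.sum_congr rfl fun y _ => ?_
    rw [Finset.sum_eq_single z]
    · simp only [glueEquiv_apply, embedOp_glue, if_true]
    · intro t _ ht
      simp [glueEquiv_apply, embedOp_glue, ht.symm]
    · simp
  · intro t _ ht
    simp [glueEquiv_apply, embedOp_glue, ht.symm]
  · simp

/-! ### Partial trace as a sum of diagonal blocks -/

/-- The qubits `f b`, together with all other qubits. -/
noncomputable def complEquiv {β ι : Type} (f : β ↪ ι) : β ⊕ {i : ι // i ∉ Set.range f} ≃ ι :=
  open Classical in
  (Equiv.sumCongr (Equiv.ofInjective f f.injective) (Equiv.refl _)).trans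
    (Equiv.sumCompl (fun i => i ∈ Set.range f))

theorem left_complEquiv {β ι : Type} (f : β ↪ ι) : left (complEquiv f) = f := by
  ext b; rfl

/-- The complement is an arbitrary `R` with a splitting `E`, so that each application can use the
decomposition that suits it, such as `compOut` or `orSplit`. -/
theorem keep_apply {β R ι : Type} [Fintype β] [Fintype R] [Fintype ι]
    [DecidableEq ι] [DecidableEq R] (f : β ↪ ι) (E : β ⊕ R ≃ ι) (hE : left E = f)
    (σ : Op (Reg ι)) (u v : Reg β) :
    keep f σ u v = ∑ r : Reg R, slice E r r σ u v := by
  classical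
  subst hE
  have hcond : ∀ (a b : Reg β) (c d : Reg R),
      (glue E a c ∘ left E = u ∧ glue E b d ∘ left E = v ∧
        ∀ q, q ∉ Set.range (left E) → glue E a c q = glue E b d q) ↔ a = u ∧ b = v ∧ c = d := by
    intro a b c d
    have h : ∀ (a : Reg β) (c : Reg R), glue E a c ∘ left E = a := by
      intro a c; funext i; simp
    rw [h, h]
    refine and_congr_right fun ha => and_congr_right fun hb => ?_
    constructor
    · intro h
      funext i
      simpa using h (E (Sum.inr i)) (by rintro ⟨j, hj⟩; simp at hj)
    · rintro rfl q hq
      obtain ⟨q, rfl⟩ := E.surjective q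
      rcases q with q | q
      · exact absurd ⟨q, rfl⟩ hq
      · simp
  simp only [keep, slice, Matrix.of_apply]
  rw [← (glueEquiv E).sum_comp, Fintype.sum_prod_type, Finset.sum_eq_single u]
  · refine Finset.sum_congr rfl fun r _ => ?_
    rw [← (glueEquiv E).sum_comp, Finset.sum_eq_single (v, r)]
    · exact if_pos ((hcond _ _ _ _).2 ⟨rfl, rfl, rfl⟩)
    · rintro ⟨b, d⟩ _ hne
      refine if_neg fun h => hne ?_
      obtain ⟨_, rfl, rfl⟩ := (hcond _ _ _ _).1 h
      rfl
    · simp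
  · intro a _ ha
    refine Finset.sum_eq_zero fun c _ => Finset.sum_eq_zero fun y _ => ?_
    obtain ⟨⟨b, d⟩, rfl⟩ := (glueEquiv E).surjective y
    exact if_neg fun h => ha ((hcond _ _ _ _).1 h).1
  · simp

theorem keep_eq_sum_slice {β R ι : Type} [Fintype β] [Fintype R] [Fintype ι]
    [DecidableEq ι] [DecidableEq R] (f : β ↪ ι) (E : β ⊕ R ≃ ι) (hE : left E = f)
    (σ : Op (Reg ι)) : keep f σ = ∑ r : Reg R, slice E r r σ := by
  ext u v
  rw [keep_apply f E hE, Matrix.sum_apply]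

theorem keep_conj {β ι : Type} [Fintype β] [DecidableEq β] [Fintype ι] [DecidableEq ι]
    (f : β ↪ ι) {m : ℕ} (g : Fin m ↪ β) (A : Op (Reg (Fin m))) (σ : Op (Reg ι)) :
    keep f (embedOp (g.trans f) A * σ * (embedOp (g.trans f) A)ᴴ) =
      embedOp g A * keep f σ * (embedOp g A)ᴴ := by
  classical
  have h := left_complEquiv f
  rw [keep_eq_sum_slice f (complEquiv f) h, keep_eq_sum_slice f (complEquiv f) h,
    Finset.mul_sum, Finset.sum_mul]
  refine Finset.sum_congr rfl fun r _ => ?_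
  conv_lhs => rw [show g.trans f = g.trans (left (complEquiv f)) by rw [h]]
  exact slice_conj _ _ _ _ _ _

/-! ### The functionality absorbs a Clifford gate into the keys -/

variable {𝒢 : GateSet} {P : Setting} {M : Finset (Fin P.W)}

/-- The Clifford gate that is applied when the control bit is `b`. -/
noncomputable def gateIf (G : cliffordGroup 1) (b : Bool) : cliffordGroup 1 := if b then G else 1

theorem embedOp_one {ι : Type} [Fintype ι] [DecidableEq ι] {m : ℕ} (f : Fin m ↪ ι) :
    embedOp f 1 = 1 := mixOp_one f

/-- Once the outcomes are fixed, the control bit is a constant. Since `w` is unmeasured, the gate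
preserves the measured values and commutes with the projection onto them. -/
theorem outcomePart_applyCtrl (G : cliffordGroup 1) (w : Fin P.W) (hw : w ∉ M)
    (ctrl : Option {l : Fin P.W // l ∈ M}) (m : {l : Fin P.W // l ∈ M} → Bool)
    (σ : Op (Reg (Fin P.W))) :
    outcomePart m (applyCtrl ctrl (embedOp (oneWire w) G.1.1) σ) =
      embedOp (oneWire w) (gateIf G (fires ctrl m)).1.1 * outcomePart m σ *
        (embedOp (oneWire w) (gateIf G (fires ctrl m)).1.1)ᴴ := by
  classical
  have hoff : ∀ (B : Op (Reg (Fin 1))) (x z : Reg (Fin P.W)), embedOp (oneWire w) B x z ≠ 0 →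
      ∀ l : {l : Fin P.W // l ∈ M}, x l.1 = z l.1 := by
    intro B x z h l
    rw [embedOp_apply] at h
    by_contra hne
    refine h (if_neg fun hall => hne (hall l.1 ?_))
    rintro ⟨i, hi⟩
    exact hw ((show w = l.1 from hi) ▸ l.2)
  set V : Op (Reg (Fin P.W)) := Matrix.of fun x y =>
    if fires ctrl (fun l => x l.1) then embedOp (oneWire w) G.1.1 x y
    else (1 : Op (Reg (Fin P.W))) x y with hV
  set A := embedOp (oneWire w) (gateIf G (fires ctrl m)).1.1 with hA
  -- Rows of the controlled operator compatible with `m` are rows of an uncontrolled one.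
  have hVA : ∀ x, (∀ l, x l.1 = m l) → ∀ z, V x z = A x z := by
    intro x hx z
    have : (fun l : {l : Fin P.W // l ∈ M} => x l.1) = m := funext hx
    rw [hV, hA, Matrix.of_apply, this]
    cases fires ctrl m
    · simp [gateIf, embedOp_one]
    · simp [gateIf]
  ext x y
  change (if ∀ l, x l.1 = m l ∧ y l.1 = m l then (V * σ * Vᴴ) x y else 0) = _
  split_ifs with h
  · simp only [Matrix.mul_apply, Matrix.conjTranspose_apply, hVA x fun l => (h l).1,
      hVA y fun l => (h l).2]
    refine Finset.sum_congr rfl fun t _ => ?_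
    by_cases hyt : A y t = 0
    · simp [hyt]
    congr 1
    refine Finset.sum_congr rfl fun z _ => ?_
    by_cases hxz : A x z = 0
    · simp [hxz]
    congr 1
    refine (if_pos fun l => ?_).symm
    rw [← hoff _ x z hxz, ← hoff _ y t hyt]
    exact h l
  · symm
    simp only [Matrix.mul_apply, Matrix.conjTranspose_apply]
    refine Finset.sum_eq_zero fun t _ => ?_
    by_cases hyt : A y t = 0
    · simp [hyt]
    refine mul_eq_zero_of_left (Finset.sum_eq_zero fun z _ => ?_) _
    by_cases hxz : A x z = 0
    · simp [hxz]
    refine mul_eq_zero_of_right _ (if_neg fun hz => h fun l => ?_)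
    rw [hoff _ x z hxz, hoff _ y t hyt]
    exact hz l

/-- The new key is the class of `E F⁻¹`, so multiplying by `F` gives back `E`. The scalar `c`
compares the representatives chosen by `Quotient.out`; only its modulus will matter. -/
theorem encodeOp_newKey {n : ℕ} (E : CliffordKey (n + 1)) (G : cliffordGroup 1) (b : Bool) :
    ∃ c : ℂ, c * star c = 1 ∧ ∀ y x, ∑ b', encodeOp (newKey E G b) y b' *
      (gateIf G b).1.1 (fun _ => b') (fun _ => x) = c * encodeOp E y x := by
  classical
  set F : cliffordGroup (n + 1) := embedClifford (oneWire 0) (gateIf G b) with hF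
  have hk : newKey E G b = QuotientGroup.mk ((Quotient.out E) * F⁻¹) := by
    have h1 : F⁻¹ = embedClifford (oneWire 0) ((gateIf G b)⁻¹) := by
      apply Subtype.ext
      exact (map_inv (embedU (oneWire (0 : Fin (n + 1)))) (gateIf G b).1).symm
    rw [h1, QuotientGroup.mk_mul]
    congr 1
    exact (Quotient.out_eq E).symm
  have hq := QuotientGroup.eq.mp
    ((show QuotientGroup.mk (s := phases (n + 1)) ((Quotient.out E) * F⁻¹) =
      QuotientGroup.mk (Quotient.out (newKey E G b)) by
        rw [← hk]; exact (Quotient.out_eq _).symm))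
  obtain ⟨c, hc⟩ := hq
  set D : cliffordGroup (n + 1) :=
    ((Quotient.out E) * F⁻¹)⁻¹ * Quotient.out (newKey E G b) with hD
  have hmul : Quotient.out (newKey E G b) * F = Quotient.out E * F⁻¹ * D * F := by
    rw [hD]; group
  have hmat : (Quotient.out (newKey E G b)).1.1 * F.1.1 = c • (Quotient.out E).1.1 := by
    have h1 := congrArg (fun g : cliffordGroup (n + 1) => (g.1.1 : Op (Reg (Fin (n + 1))))) hmul
    have h2 : (F⁻¹).1.1 * F.1.1 = 1 :=
      congrArg (fun g : cliffordGroup (n + 1) => (g.1.1 : Op (Reg (Fin (n + 1)))))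
        (inv_mul_cancel F)
    change (Quotient.out (newKey E G b)).1.1 * F.1.1 =
      (Quotient.out E).1.1 * (F⁻¹).1.1 * D.1.1 * F.1.1 at h1
    rw [h1]
    have hc' : D.1.1 = c • 1 := hc
    rw [hc', Matrix.mul_smul, Matrix.mul_one, Matrix.smul_mul, mul_assoc, h2, mul_one]
  refine ⟨c, ?_, fun y x => ?_⟩
  -- A scalar matrix that is unitary has modulus one: read off one diagonal entry.
  · have h1 := Matrix.mem_unitaryGroup_iff.mp D.1.2
    have hc' : D.1.1 = c • 1 := hc
    rw [hc'] at h1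
    have := congrFun (congrFun h1 fun _ => false) fun _ => false
    simpa [Matrix.one_apply, mul_comm] using this
  · have h := congrFun (congrFun hmat y) (Fin.cons x fun _ => false)
    rw [Matrix.smul_apply, smul_eq_mul] at h
    refine Eq.trans ?_ h
    rw [Matrix.mul_apply]
    have hFa : ∀ z, F.1.1 z (Fin.cons x fun _ => false) =
        embedOp (oneWire 0) (gateIf G b).1.1 z (Fin.cons x fun _ => false) := fun z => rfl
    simp only [hFa, embedOp_apply]
    -- `F` is the identity on the traps, so only labels whose trap bits are all `0` contribute.
    refine Finset.sum_of_injOn (fun b' => (Fin.cons b' fun _ => false : Reg (Fin (n + 1))))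
      ?_ ?_ ?_ ?_
    · intro p _ q _ hpq
      simpa using congrFun hpq 0
    · simp
    · intro z _ hz
      refine mul_eq_zero_of_right _ (if_neg fun hall => hz ?_)
      refine ⟨z 0, by simp, ?_⟩
      funext i
      refine Fin.cases rfl (fun i => ?_) i
      have := hall i.succ (by
        rintro ⟨j, hj⟩
        exact Fin.succ_ne_zero i hj.symm)
      simpa using this.symm
    · intro b' _
      rw [if_pos]
      · rfl
      · intro i hi
        refine Fin.cases (fun hi => absurd ⟨0, rfl⟩ hi) (fun i _ => by simp) i hi

/-- The encoder is a product over the wires, and key update and gate affect only the factor at `w`.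
-/
theorem encodeAllOp_updateKey (G : cliffordGroup 1) (w : P.OutWire)
    (ctrl : Option {l : Fin P.W // l ∈ M}) (s : P.Record M) :
    ∃ c : ℂ, c * star c = 1 ∧ encodeAllOp (updateKey G w ctrl s).1 *
      embedOp (oneWire w) (gateIf G (fires ctrl s.2)).1.1 = c • encodeAllOp s.1 := by
  classical
  obtain ⟨c, hc, h⟩ := encodeOp_newKey (s.1 w) G (fires ctrl s.2)
  refine ⟨c, hc, ?_⟩
  ext y x
  simp only [Matrix.mul_apply, Matrix.smul_apply, smul_eq_mul, encodeAllOp, Matrix.of_apply]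
  have hsum : ∀ x', (∏ v, encodeOp ((updateKey G w ctrl s).1 v) (fun j => y (v, j)) (x' v)) *
      embedOp (oneWire w) (gateIf G (fires ctrl s.2)).1.1 x' x =
      if ∀ i, i ∉ Set.range (oneWire w) → x' i = x i then
        (∏ v, encodeOp ((updateKey G w ctrl s).1 v) (fun j => y (v, j)) (x' v)) *
        (gateIf G (fires ctrl s.2)).1.1 (x' ∘ oneWire w) (x ∘ oneWire w) else 0 := by
    intro x'
    rw [embedOp_apply]
    split_ifs <;> simp
  simp only [hsum]
  rw [← Finset.mul_prod_erase Finset.univ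
    (fun v => encodeOp (s.1 v) (fun j => y (v, j)) (x v)) (Finset.mem_univ w), ← mul_assoc,
    ← h, Finset.sum_mul]
  symm
  refine Finset.sum_of_injOn (fun b => Function.update x w b) ?_ ?_ ?_ ?_
  · intro p _ q _ hpq
    simpa using congrFun hpq w
  · simp
  · intro z _ hz
    refine if_neg fun hall => hz ⟨z w, by simp, ?_⟩
    funext i
    by_cases hi : i = w
    · subst hi; simp
    · refine (Function.update_of_ne hi _ _).trans ?_
      refine (hall i ?_).symm
      rintro ⟨_, rfl⟩
      exact hi rfl
  · intro b _
    have hne : ∀ i, i ∉ Set.range (oneWire w) → i ≠ w := by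
      rintro i hi rfl
      exact hi ⟨0, rfl⟩
    rw [if_pos fun i hi => Function.update_of_ne (hne i hi) _ _,
      ← Finset.mul_prod_erase Finset.univ _ (Finset.mem_univ w)]
    have h1 : ∏ v ∈ Finset.univ.erase w, encodeOp ((updateKey G w ctrl s).1 v)
        (fun j => y (v, j)) (Function.update x w b v) =
        ∏ v ∈ Finset.univ.erase w, encodeOp (s.1 v) (fun j => y (v, j)) (x v) := by
      refine Finset.prod_congr rfl fun v hv => ?_
      have hv := Finset.ne_of_mem_erase hv
      simp only [updateKey, Function.update_of_ne hv]
    rw [h1]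
    have h2 : Function.update x w b ∘ oneWire w = fun _ => b := by
      funext i
      exact Function.update_self _ _ _
    have h3 : x ∘ oneWire w = fun _ => x w := rfl
    rw [h2, h3]
    simp only [updateKey, Function.update_self]
    ring

theorem functionality_clifford (C : Circuit P.W M) (G : cliffordGroup 1) (w : P.OutWire)
    (hw : w.1 ∉ M) (ctrl : Option {l : Fin P.W // l ∈ M}) (s : P.Record M)
    (ρ : Op (Reg P.InWire)) :
    functionality (C.clifford G w.1 hw ctrl) (updateKey G w ctrl s) ρ = functionality C s ρ := by
  obtain ⟨c, hc, h⟩ := encodeAllOp_updateKey G w ctrl s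
  simp only [functionality, Circuit.run]
  congr 1
  have h2 : (updateKey G w ctrl s).2 = s.2 := rfl
  rw [h2, outcomePart_applyCtrl G w.1 hw]
  -- As `w` is an output wire, the gate acts on kept qubits and can be moved past the partial trace.
  have hwire : oneWire w.1 = (oneWire w).trans
      (Function.Embedding.subtype fun v : Fin P.W => P.outOwner v ≠ none) := rfl
  rw [hwire, keep_conj]
  set τ := keep (Function.Embedding.subtype fun v : Fin P.W => P.outOwner v ≠ none)
    (outcomePart s.2 (C.run (addZeros (Function.Embedding.subtype _) ρ)))
  have h3 : ∀ A B : Op (Reg P.OutWire), ∀ X : Matrix (Reg (P.OutWire × Fin (P.n + 1)))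
      (Reg P.OutWire) ℂ, X * (A * B * Aᴴ) * Xᴴ = (X * A) * B * (X * A)ᴴ := by
    intro A B X
    simp only [Matrix.conjTranspose_mul, Matrix.mul_assoc]
  rw [h3, h, Matrix.conjTranspose_smul, Matrix.smul_mul, Matrix.smul_mul, Matrix.mul_smul,
    smul_smul, hc, one_smul]

/-- For fixed outcomes this is a right translation of one key by a group element. The bijection is
what turns uniformity of the keys into a reindexing of the sum over records. -/
theorem updateKey_bijective (G : cliffordGroup 1) (w : P.OutWire)
    (ctrl : Option {l : Fin P.W // l ∈ M}) :
    Function.Bijective (updateKey G w ctrl : P.Record M → P.Record M) := by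
  refine Finite.injective_iff_bijective.mp ?_
  rintro ⟨s, m⟩ ⟨s', m'⟩ h
  obtain ⟨h1, h2⟩ := Prod.ext_iff.mp h
  obtain rfl : m = m' := h2
  refine Prod.ext (funext fun v => ?_) rfl
  have hv := congrFun h1 v
  by_cases hvw : v = w
  · subst hvw
    simpa [updateKey, newKey] using hv
  · simpa [updateKey, Function.update_of_ne hvw] using hv

/-! ### Composition of circuits -/

/-- Place a gate on other qubits. -/
def Gate.map {ι ι' : Type} (j : ι ↪ ι') (g : Gate 𝒢 ι) : Gate 𝒢 ι' :=
  ⟨g.arity, g.op, g.mem, g.wires.trans j⟩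

/-- Apply a sequence of gates to a state. -/
noncomputable def applyGates {ι : Type} [Fintype ι] [DecidableEq ι] (L : List (Gate 𝒢 ι))
    (σ : Op (Reg ι)) : Op (Reg ι) :=
  L.foldl (fun σ g => embedOp g.wires g.op.1 * σ * (embedOp g.wires g.op.1)ᴴ) σ

theorem applyGates_cons {ι : Type} [Fintype ι] [DecidableEq ι] (g : Gate 𝒢 ι)
    (L : List (Gate 𝒢 ι)) (σ : Op (Reg ι)) : applyGates (g :: L) σ =
      applyGates L (embedOp g.wires g.op.1 * σ * (embedOp g.wires g.op.1)ᴴ) := rfl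

theorem applyGates_append {ι : Type} [Fintype ι] [DecidableEq ι] (L L' : List (Gate 𝒢 ι))
    (σ : Op (Reg ι)) : applyGates (L ++ L') σ = applyGates L' (applyGates L σ) :=
  List.foldl_append

theorem applyGates_zero {ι : Type} [Fintype ι] [DecidableEq ι] (L : List (Gate 𝒢 ι)) :
    applyGates L 0 = 0 := by
  induction L with
  | nil => rfl
  | cons g L ih => rw [applyGates_cons, Matrix.mul_zero, Matrix.zero_mul, ih]

theorem applyGates_sum {ι : Type} [Fintype ι] [DecidableEq ι] (L : List (Gate 𝒢 ι))
    {κ : Type} (s : Finset κ) (σ : κ → Op (Reg ι)) :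
    applyGates L (∑ k ∈ s, σ k) = ∑ k ∈ s, applyGates L (σ k) := by
  induction L generalizing σ with
  | nil => rfl
  | cons g L ih => simp only [applyGates_cons, Matrix.mul_sum, Matrix.sum_mul, ih]

theorem slice_applyGates {κ κ' ι : Type} [Fintype κ] [DecidableEq κ] [Fintype κ'] [Fintype ι]
    [DecidableEq ι] [DecidableEq κ'] (E : κ ⊕ κ' ≃ ι) (L : List (Gate 𝒢 κ))
    (z z' : Reg κ') (σ : Op (Reg ι)) :
    slice E z z' (applyGates (L.map (Gate.map (left E))) σ) = applyGates L (slice E z z' σ) := by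
  induction L generalizing σ with
  | nil => rfl
  | cons g L ih =>
    rw [List.map_cons, applyGates_cons, applyGates_cons, ih]
    congr 1
    exact slice_conj _ _ _ _ _ _

theorem addZeros_inl {α : Type} [Fintype α] [DecidableEq α] {a : ℕ} (ρ : Op (Reg α))
    (x y : Reg (α ⊕ Fin a)) [Decidable (x ∘ Sum.inr = (fun _ => false) ∧
      y ∘ Sum.inr = fun _ => false)] :
    addZeros Function.Embedding.inl ρ x y =
      if x ∘ Sum.inr = (fun _ => false) ∧ y ∘ Sum.inr = (fun _ => false) then
        ρ (x ∘ Sum.inl) (y ∘ Sum.inl) else 0 := by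
  classical
  refine if_congr ?_ rfl rfl
  constructor
  · intro h
    exact ⟨funext fun k => (h (Sum.inr k) (by simp)).1, funext fun k => (h (Sum.inr k) (by simp)).2⟩
  · rintro ⟨hx, hy⟩ (q | q) hq
    · exact absurd ⟨q, rfl⟩ hq
    · exact ⟨congrFun hx q, congrFun hy q⟩

theorem addZeros_sum {α ι : Type} [Fintype ι] [DecidableEq ι] [Fintype α] (f : α ↪ ι)
    {κ : Type} (s : Finset κ) (ρ : κ → Op (Reg α)) :
    addZeros f (∑ k ∈ s, ρ k) = ∑ k ∈ s, addZeros f (ρ k) := by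
  ext x y
  simp only [addZeros, Matrix.of_apply, Matrix.sum_apply]
  split_ifs <;> simp

namespace PartyCircuit

variable {α β γ δ : Type}

theorem run_eq [Fintype α] [DecidableEq α] (K : PartyCircuit 𝒢 α β) (ρ : Op (Reg α)) :
    K.run ρ = keep K.out (applyGates K.gates (addZeros Function.Embedding.inl ρ)) := rfl

/-- Rename the output qubits. -/
def relabelOut (K : PartyCircuit 𝒢 α β) (e : γ ≃ β) : PartyCircuit 𝒢 α γ :=
  ⟨K.anc, K.gates, e.toEmbedding.trans K.out⟩

theorem relabelOut_run [Fintype α] [DecidableEq α] [Fintype β] [Fintype γ] (K : PartyCircuit 𝒢 α β) (e : γ ≃ β)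
    (ρ : Op (Reg α)) (u v : Reg γ) :
    (K.relabelOut e).run ρ u v = K.run ρ (u ∘ e.symm) (v ∘ e.symm) := by
  classical
  rw [run_eq, run_eq, keep_apply K.out (complEquiv K.out) (left_complEquiv _),
    keep_apply (K.relabelOut e).out ((Equiv.sumCongr e (Equiv.refl _)).trans (complEquiv K.out))
      (by ext b; rfl)]
  refine Finset.sum_congr rfl fun r _ => ?_
  have h : ∀ u : Reg γ, glue ((Equiv.sumCongr e (Equiv.refl _)).trans (complEquiv K.out)) u r =
      glue (complEquiv K.out) (u ∘ e.symm) r := by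
    intro u
    funext i
    obtain ⟨i, rfl⟩ := ((Equiv.sumCongr e (Equiv.refl _)).trans (complEquiv K.out)).surjective i
    rcases i with i | i
    · rw [glue_inl]
      exact ((glue_inl (complEquiv K.out) (u ∘ e.symm) r (e i)).trans (by simp)).symm
    · rw [glue_inr]
      exact (glue_inr (complEquiv K.out) (u ∘ e.symm) r i).symm
  exact congrArg₂ (applyGates K.gates (addZeros Function.Embedding.inl ρ)) (h u) (h v)

/-- The qubits of two circuits run in sequence: those of the first, and the ancillas of the
second. -/
def compWires (α : Type) (a b : ℕ) : (α ⊕ Fin a) ⊕ Fin b ≃ α ⊕ Fin (a + b) :=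
  (Equiv.sumAssoc _ _ _).trans (Equiv.sumCongr (Equiv.refl _) finSumFinEquiv)

/-- The qubits of two circuits run in sequence: those of the second, the outputs of the first that
bypass the second, and the qubits that the first discards. -/
noncomputable def compSplit (K : PartyCircuit 𝒢 α (β ⊕ γ)) (b : ℕ) :
    (β ⊕ Fin b) ⊕ (γ ⊕ {q // q ∉ Set.range K.out}) ≃ α ⊕ Fin (K.anc + b) :=
  ((Equiv.sumSumSumComm _ _ _ _).trans ((Equiv.sumCongr (Equiv.refl _) (Equiv.sumComm _ _)).trans
    (Equiv.sumAssoc _ _ _).symm)).trans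
    ((Equiv.sumCongr (complEquiv K.out) (Equiv.refl _)).trans (compWires α K.anc b))

/-- The qubits of two circuits run in sequence: the outputs, and the qubits that are discarded. -/
noncomputable def compOut (K : PartyCircuit 𝒢 α (β ⊕ γ)) (K' : PartyCircuit 𝒢 β δ) :
    (δ ⊕ γ) ⊕ ({q // q ∉ Set.range K'.out} ⊕ {q // q ∉ Set.range K.out}) ≃
      α ⊕ Fin (K.anc + K'.anc) :=
  (Equiv.sumSumSumComm _ _ _ _).trans
    ((Equiv.sumCongr (complEquiv K'.out) (Equiv.refl _)).trans (K.compSplit K'.anc))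

/-- Run `K`, and then `K'` on the first part of the output of `K`. -/
noncomputable def comp (K : PartyCircuit 𝒢 α (β ⊕ γ)) (K' : PartyCircuit 𝒢 β δ) :
    PartyCircuit 𝒢 α (δ ⊕ γ) where
  anc := K.anc + K'.anc
  gates := K.gates.map (Gate.map (left (compWires α K.anc K'.anc))) ++
    K'.gates.map (Gate.map (left (K.compSplit K'.anc)))
  out := left (K.compOut K')

theorem glue_compOut (K : PartyCircuit 𝒢 α (β ⊕ γ)) (K' : PartyCircuit 𝒢 β δ) (d : Reg δ)
    (g : Reg γ) (r' : Reg {q // q ∉ Set.range K'.out}) (r : Reg {q // q ∉ Set.range K.out}) :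
    glue (K.compOut K') (Sum.elim d g) (Sum.elim r' r) =
      glue (K.compSplit K'.anc) (glue (complEquiv K'.out) d r') (Sum.elim g r) := by
  funext i
  obtain ⟨i, rfl⟩ := (K.compOut K').surjective i
  rcases i with (i | i) | (i | i)
  · rw [glue_inl]
    exact ((glue_inl (K.compSplit K'.anc) _ (Sum.elim g r) (complEquiv K'.out (Sum.inl i))).trans
      (glue_inl (complEquiv K'.out) d r' i)).symm
  · rw [glue_inl]
    exact (glue_inr (K.compSplit K'.anc) (glue (complEquiv K'.out) d r') (Sum.elim g r)
      (Sum.inl i)).symm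
  · rw [glue_inr]
    exact ((glue_inl (K.compSplit K'.anc) _ (Sum.elim g r) (complEquiv K'.out (Sum.inr i))).trans
      (glue_inr (complEquiv K'.out) d r' i)).symm
  · rw [glue_inr]
    exact (glue_inr (K.compSplit K'.anc) (glue (complEquiv K'.out) d r') (Sum.elim g r)
      (Sum.inr i)).symm

theorem glue_compSplit (K : PartyCircuit 𝒢 α (β ⊕ γ)) (b : ℕ) (u : Reg (β ⊕ Fin b))
    (g : Reg γ) (r : Reg {q // q ∉ Set.range K.out}) :
    glue (K.compSplit b) u (Sum.elim g r) = glue (compWires α K.anc b)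
      (glue (complEquiv K.out) (Sum.elim (u ∘ Sum.inl) g) r) (u ∘ Sum.inr) := by
  funext i
  obtain ⟨i, rfl⟩ := (K.compSplit b).surjective i
  set a := Sum.elim (u ∘ Sum.inl) g with ha
  rcases i with (i | i) | (i | i)
  · rw [glue_inl]
    exact ((glue_inl (compWires α K.anc b) _ (u ∘ Sum.inr)
      (complEquiv K.out (Sum.inl (Sum.inl i)))).trans (glue_inl _ a r (Sum.inl i))).symm
  · rw [glue_inl]
    exact (glue_inr (compWires α K.anc b) (glue (complEquiv K.out) a r) (u ∘ Sum.inr) i).symm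
  · rw [glue_inr]
    exact ((glue_inl (compWires α K.anc b) _ (u ∘ Sum.inr)
      (complEquiv K.out (Sum.inl (Sum.inr i)))).trans (glue_inl _ a r (Sum.inr i))).symm
  · rw [glue_inr]
    exact ((glue_inl (compWires α K.anc b) _ (u ∘ Sum.inr) (complEquiv K.out (Sum.inr i))).trans
      (glue_inr _ a r i)).symm

/-- Adjoining all ancillas at the start is adjoining those of the second circuit later: they stay at
`0` while the first one runs. -/
theorem slice_addZeros [Fintype α] [DecidableEq α] (a b : ℕ) (z z' : Reg (Fin b)) (ρ : Op (Reg α)) :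
    slice (compWires α a b) z z' (addZeros Function.Embedding.inl ρ) =
      if z = (fun _ => false) ∧ z' = (fun _ => false) then
        addZeros Function.Embedding.inl ρ else 0 := by
  classical
  ext u v
  have hl : ∀ (u : Reg (α ⊕ Fin a)) (z : Reg (Fin b)),
      glue (compWires α a b) u z ∘ Sum.inl = u ∘ Sum.inl := fun u z => rfl
  have hr : ∀ (u : Reg (α ⊕ Fin a)) (z : Reg (Fin b)),
      glue (compWires α a b) u z ∘ Sum.inr = (fun _ => false) ↔
        u ∘ Sum.inr = (fun _ => false) ∧ z = fun _ => false := by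
    intro u z
    constructor
    · intro h
      constructor
      · funext k
        have := congrFun h (finSumFinEquiv (Sum.inl k))
        rw [← this]
        exact (glue_inl (compWires α a b) u z (Sum.inr k)).symm
      · funext k
        have := congrFun h (finSumFinEquiv (Sum.inr k))
        rw [← this]
        exact (glue_inr (compWires α a b) u z k).symm
    · rintro ⟨h1, h2⟩
      funext k
      obtain ⟨k, rfl⟩ := finSumFinEquiv.surjective k
      rcases k with k | k
      · exact (glue_inl (compWires α a b) u z (Sum.inr k)).trans (congrFun h1 k)
      · exact (glue_inr (compWires α a b) u z k).trans (congrFun h2 k)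
  simp only [slice, Matrix.of_apply, addZeros_inl, hl, hr]
  by_cases hz : z = (fun _ => false) ∧ z' = (fun _ => false)
  · rw [if_pos hz, addZeros_inl]
    exact if_congr (by tauto) rfl rfl
  · rw [if_neg hz, if_neg (by tauto)]
    rfl

/-- Discarding can be deferred: the gates of `K'` do not touch the bypassing qubits `γ` or those
discarded by `K`, so they act block by block in the labels of these. For `g ≠ g'` the block fed to
`K'` need not be a state, which is harmless because `run` is defined on all matrices. -/
theorem comp_run [Fintype α] [DecidableEq α] [Fintype β] [DecidableEq β] [Fintype γ]
    [DecidableEq γ] [Fintype δ] (K : PartyCircuit 𝒢 α (β ⊕ γ)) (K' : PartyCircuit 𝒢 β δ) (ρ : Op (Reg α)) (d d' : Reg δ)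
    (g g' : Reg γ) :
    (K.comp K').run ρ (Sum.elim d g) (Sum.elim d' g') =
      K'.run (Matrix.of fun p q => K.run ρ (Sum.elim p g) (Sum.elim q g')) d d' := by
  classical
  set τ := applyGates K.gates (addZeros Function.Embedding.inl ρ) with hτ
  -- The contribution to the input of `K'` from the value `r` of the qubits discarded by `K`.
  let B : Reg {q // q ∉ Set.range K.out} → Op (Reg β) := fun r =>
    Matrix.of fun p q => slice (complEquiv K.out) r r τ (Sum.elim p g) (Sum.elim q g')
  have hB : (Matrix.of fun p q => K.run ρ (Sum.elim p g) (Sum.elim q g')) = ∑ r, B r := by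
    ext p q
    rw [Matrix.of_apply, run_eq, keep_apply K.out (complEquiv K.out) (left_complEquiv _),
      Matrix.sum_apply]
    rfl
  have hτ' : ∀ r, slice (K.compSplit K'.anc) (Sum.elim g r) (Sum.elim g' r)
      (applyGates (K.gates.map (Gate.map (left (compWires α K.anc K'.anc))))
        (addZeros Function.Embedding.inl ρ)) = addZeros Function.Embedding.inl (B r) := by
    intro r
    ext u v
    have h := congrFun (congrFun (slice_applyGates (compWires α K.anc K'.anc) K.gates
      (u ∘ Sum.inr) (v ∘ Sum.inr) (addZeros Function.Embedding.inl ρ))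
      (glue (complEquiv K.out) (Sum.elim (u ∘ Sum.inl) g) r))
      (glue (complEquiv K.out) (Sum.elim (v ∘ Sum.inl) g') r)
    rw [slice_addZeros] at h
    simp only [slice, Matrix.of_apply, glue_compSplit] at h ⊢
    rw [h, addZeros_inl]
    split_ifs
    · rfl
    · rw [applyGates_zero]; rfl
  -- The final partial trace runs over pairs `(r', r)`; by linearity the sum over `r` can be taken
  -- before or after the gates of `K'`.
  rw [hB, run_eq, run_eq, keep_apply (K.comp K').out (K.compOut K') rfl,
    keep_apply K'.out (complEquiv K'.out) (left_complEquiv _), addZeros_sum, applyGates_sum,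
    ← (Equiv.sumArrowEquivProdArrow _ _ Bool).symm.sum_comp, Fintype.sum_prod_type]
  refine Finset.sum_congr rfl fun r' _ => ?_
  have hs : slice (complEquiv K'.out) r' r'
      (∑ r, applyGates K'.gates (addZeros Function.Embedding.inl (B r))) d d' =
      ∑ r, applyGates K'.gates (addZeros Function.Embedding.inl (B r))
        (glue (complEquiv K'.out) d r') (glue (complEquiv K'.out) d' r') := by
    simp only [slice, Matrix.of_apply, Matrix.sum_apply]
  rw [hs]
  refine Finset.sum_congr rfl fun r _ => ?_
  rw [← hτ', ← slice_applyGates, ← applyGates_append]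
  exact congrArg₂ (applyGates (K.comp K').gates (addZeros Function.Embedding.inl ρ))
    (glue_compOut K K' d g r' r) (glue_compOut K K' d' g' r' r)

theorem comp_size [Fintype α] [Fintype β] (K : PartyCircuit 𝒢 α (β ⊕ γ))
    (K' : PartyCircuit 𝒢 β δ) : (K.comp K').size ≤ K.size + K'.size := by
  simp only [size, comp, List.length_append, List.length_map]
  omega

end PartyCircuit

/-! ### A circuit for the disjunction of two registers -/

/-- Conjugation by a basis permutation reindexes by its inverse. Both gates needed are involutions,
hence `h` serves as its own inverse. -/
theorem permGate_conj {ι : Type} [Fintype ι] [DecidableEq ι] {m : ℕ} (f : Fin m ↪ ι)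
    (π : Equiv.Perm (Reg (Fin m))) (h : Reg ι → Reg ι) (hh : ∀ x, h (h x) = x)
    (hf : ∀ x, h x ∘ f = π (x ∘ f)) (hoff : ∀ x q, q ∉ Set.range f → h x q = x q)
    (σ : Op (Reg ι)) :
    embedOp f (permGate π).1 * σ * (embedOp f (permGate π).1)ᴴ = σ.submatrix h h := by
  classical
  have hV : ∀ x y, embedOp f (permGate π).1 x y = if y = h x then 1 else 0 := by
    intro x y
    rw [embedOp_apply]
    simp only [permGate, Matrix.of_apply]
    rw [← ite_and]
    refine if_congr ?_ rfl rfl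
    rw [← hf]
    constructor
    · rintro ⟨h1, h2⟩
      suffices hx : x = h y by rw [hx, hh]
      funext q
      by_cases hq : q ∈ Set.range f
      · obtain ⟨j, rfl⟩ := hq
        exact congrFun h2 j
      · rw [hoff _ _ hq, h1 q hq]
    · rintro rfl
      rw [hh]
      exact ⟨fun q hq => (hoff _ _ hq).symm, rfl⟩
  ext x y
  simp [Matrix.mul_apply, hV]

/-- Three distinct wires, as a selection of wires. -/
def threeWires {ι : Type} (a b c : ι) (hab : a ≠ b) (hac : a ≠ c) (hbc : b ≠ c) : Fin 3 ↪ ι :=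
  ⟨![a, b, c], by
    intro i j hij
    fin_cases i <;> fin_cases j <;> simp_all⟩

theorem notGate_conj {ι : Type} [Fintype ι] [DecidableEq ι] (w : ι) (σ : Op (Reg ι)) :
    embedOp (oneWire w) notGate.1 * σ * (embedOp (oneWire w) notGate.1)ᴴ =
      σ.submatrix (fun x => Function.update x w (!(x w)))
        (fun x => Function.update x w (!(x w))) := by
  refine permGate_conj _ _ _ (by simp) (fun x => ?_) (fun x q hq => ?_) σ
  · funext i
    exact Function.update_self _ _ _
  · exact Function.update_of_ne (fun h => hq ⟨0, h.symm⟩) _ _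

theorem toffoliGate_conj {ι : Type} [Fintype ι] [DecidableEq ι] (a b c : ι) (hab : a ≠ b)
    (hac : a ≠ c) (hbc : b ≠ c) (σ : Op (Reg ι)) :
    embedOp (threeWires a b c hab hac hbc) toffoliGate.1 * σ *
      (embedOp (threeWires a b c hab hac hbc) toffoliGate.1)ᴴ =
      σ.submatrix (fun x => Function.update x c (xor (x c) (x a && x b)))
        (fun x => Function.update x c (xor (x c) (x a && x b))) := by
  refine permGate_conj _ _ _ (by simp [hac, hbc]) (fun x => ?_) (fun x q hq => ?_) σ
  · funext i
    fin_cases i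
    · exact Function.update_of_ne hac _ _
    · exact Function.update_of_ne hbc _ _
    · exact Function.update_self _ _ _
  · exact Function.update_of_ne (fun h => hq ⟨2, h.symm⟩) _ _

section Disjunction

variable {κ : Type} [Fintype κ]

/-- The gates that write the disjunction of the bits `inl (inl i)` and `inl (inr i)` to the `i`-th
ancilla. -/
noncomputable def orStep (hnot : ⟨1, notGate⟩ ∈ 𝒢) (htof : ⟨3, toffoliGate⟩ ∈ 𝒢) (i : κ) :
    List (Gate 𝒢 ((κ ⊕ κ) ⊕ Fin (Fintype.card κ))) :=
  -- De Morgan: negate both inputs, take their conjunction, negate the result. The inputs are left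
  -- negated, as they are discarded anyway.
  [⟨1, notGate, hnot, oneWire (Sum.inl (Sum.inl i))⟩,
    ⟨1, notGate, hnot, oneWire (Sum.inl (Sum.inr i))⟩,
    ⟨3, toffoliGate, htof, threeWires (Sum.inl (Sum.inl i)) (Sum.inl (Sum.inr i))
      (Sum.inr (Fintype.equivFin κ i)) (by simp) (by simp) (by simp)⟩,
    ⟨1, notGate, hnot, oneWire (Sum.inr (Fintype.equivFin κ i))⟩]

/-- The inverse of the permutation of the basis states that the steps for `i ∈ s` perform. -/
noncomputable def orPerm [DecidableEq κ] (s : Finset κ)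
    (x : Reg ((κ ⊕ κ) ⊕ Fin (Fintype.card κ))) : Reg ((κ ⊕ κ) ⊕ Fin (Fintype.card κ)) :=
  Sum.elim (Sum.elim
    (fun i => if i ∈ s then !(x (Sum.inl (Sum.inl i))) else x (Sum.inl (Sum.inl i)))
    (fun i => if i ∈ s then !(x (Sum.inl (Sum.inr i))) else x (Sum.inl (Sum.inr i))))
    (fun k => if (Fintype.equivFin κ).symm k ∈ s then
      xor (!(x (Sum.inr k))) (x (Sum.inl (Sum.inl ((Fintype.equivFin κ).symm k))) &&
        x (Sum.inl (Sum.inr ((Fintype.equivFin κ).symm k)))) else x (Sum.inr k))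

theorem applyGates_orStep [DecidableEq κ] (hnot : ⟨1, notGate⟩ ∈ 𝒢) (htof : ⟨3, toffoliGate⟩ ∈ 𝒢)
    (i : κ) (σ : Op (Reg ((κ ⊕ κ) ⊕ Fin (Fintype.card κ)))) :
    applyGates (orStep hnot htof i) σ = σ.submatrix (orPerm {i}) (orPerm {i}) := by
  simp only [orStep, applyGates_cons, notGate_conj, toffoliGate_conj, Matrix.submatrix_submatrix]
  have h : ∀ f g : Reg ((κ ⊕ κ) ⊕ Fin (Fintype.card κ)) → Reg ((κ ⊕ κ) ⊕ Fin (Fintype.card κ)),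
      f = g → applyGates ([] : List (Gate 𝒢 _)) (σ.submatrix f f) = σ.submatrix g g := by
    rintro f g rfl; rfl
  refine h _ _ (funext fun x => funext fun q => ?_)
  rcases q with (j | j) | k
  · by_cases hj : j = i <;> simp [orPerm, hj]
  · by_cases hj : j = i <;> simp [orPerm, hj]
  · obtain ⟨j, rfl⟩ := (Fintype.equivFin κ).surjective k
    by_cases hj : j = i <;> simp [orPerm, hj]

/-- Steps for different indices act on disjoint qubits. `Nodup` is needed because a repeated step
would negate the inputs twice. -/
theorem applyGates_orSteps [DecidableEq κ] (hnot : ⟨1, notGate⟩ ∈ 𝒢) (htof : ⟨3, toffoliGate⟩ ∈ 𝒢)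
    (l : List κ) (hl : l.Nodup) (σ : Op (Reg ((κ ⊕ κ) ⊕ Fin (Fintype.card κ)))) :
    applyGates (l.flatMap (orStep hnot htof)) σ =
      σ.submatrix (orPerm l.toFinset) (orPerm l.toFinset) := by
  induction l generalizing σ with
  | nil =>
    have h : orPerm (∅ : Finset κ) = id := by
      funext x q
      rcases q with (j | j) | k <;> simp [orPerm]
    rw [List.toFinset_nil, h]
    rfl
  | cons i l ih =>
    obtain ⟨hi, hl⟩ := List.nodup_cons.mp hl
    rw [List.flatMap_cons, applyGates_append, applyGates_orStep, ih hl,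
      Matrix.submatrix_submatrix]
    have h : orPerm {i} ∘ orPerm l.toFinset = orPerm (i :: l).toFinset := by
      funext x q
      rcases q with (j | j) | k
      · by_cases hj : j = i
        · subst hj; simp [orPerm, hi]
        · simp [orPerm, hj]
      · by_cases hj : j = i
        · subst hj; simp [orPerm, hi]
        · simp [orPerm, hj]
      · obtain ⟨j, rfl⟩ := (Fintype.equivFin κ).surjective k
        by_cases hj : j = i
        · subst hj; simp [orPerm, hi]
        · simp [orPerm, hj]
    rw [h]

/-- The qubits of the disjunction circuit: the outputs, and the inputs. -/
noncomputable def orSplit (κ : Type) [Fintype κ] :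
    κ ⊕ (κ ⊕ κ) ≃ (κ ⊕ κ) ⊕ Fin (Fintype.card κ) :=
  (Equiv.sumComm _ _).trans (Equiv.sumCongr (Equiv.refl _) (Fintype.equivFin κ))

/-- The circuit that computes the bitwise disjunction of two registers. -/
noncomputable def orCircuit (κ : Type) [Fintype κ] (hnot : ⟨1, notGate⟩ ∈ 𝒢)
    (htof : ⟨3, toffoliGate⟩ ∈ 𝒢) : PartyCircuit 𝒢 (κ ⊕ κ) κ where
  anc := Fintype.card κ
  gates := Finset.univ.toList.flatMap (orStep hnot htof)
  out := left (orSplit κ)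

/-- Each index costs four gates, two input qubits and one ancilla. -/
theorem orCircuit_size (hnot : ⟨1, notGate⟩ ∈ 𝒢) (htof : ⟨3, toffoliGate⟩ ∈ 𝒢) :
    (orCircuit κ hnot htof).size = 7 * Fintype.card κ := by
  simp [PartyCircuit.size, orCircuit, List.length_flatMap, orStep]
  ring

/-- Measuring the output of the disjunction circuit. -/
theorem orCircuit_run [DecidableEq κ] (hnot : ⟨1, notGate⟩ ∈ 𝒢) (htof : ⟨3, toffoliGate⟩ ∈ 𝒢)
    (ρ : Op (Reg (κ ⊕ κ))) (u : Reg κ) :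
    (orCircuit κ hnot htof).run ρ u u = ∑ b : Reg κ, ∑ b' : Reg κ,
      if (fun i => b i || b' i) = u then ρ (Sum.elim b b') (Sum.elim b b') else 0 := by
  classical
  rw [PartyCircuit.run_eq, keep_apply (orCircuit κ hnot htof).out (orSplit κ) rfl]
  -- The discarded inputs end up negated, so the trace is parametrised by the negations of `b` and
  -- `b'`.
  let ν : Reg κ ≃ Reg κ := Function.Involutive.toPerm (fun x i => !(x i)) (by intro x; simp)
  let e : Reg κ × Reg κ ≃ Reg (κ ⊕ κ) :=
    (Equiv.prodCongr ν ν).trans (Equiv.sumArrowEquivProdArrow κ κ Bool).symm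
  rw [← e.sum_comp, Fintype.sum_prod_type]
  refine Finset.sum_congr rfl fun b _ => Finset.sum_congr rfl fun b' _ => ?_
  have he : e (b, b') = Sum.elim (fun i => !(b i)) (fun i => !(b' i)) := rfl
  have h := congrFun (congrFun (applyGates_orSteps hnot htof Finset.univ.toList
    (Finset.nodup_toList _) (addZeros Function.Embedding.inl ρ))
    (glue (orSplit κ) u (e (b, b')))) (glue (orSplit κ) u (e (b, b')))
  refine h.trans ?_
  rw [Matrix.submatrix_apply, addZeros_inl, Finset.toList_toFinset, he]
  set x := glue (orSplit κ) u (Sum.elim (fun i => !(b i)) (fun i => !(b' i))) with hx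
  have h1 : ∀ i, x (Sum.inl (Sum.inl i)) = !(b i) := fun i =>
    glue_inr (orSplit κ) u _ (Sum.inl i)
  have h2 : ∀ i, x (Sum.inl (Sum.inr i)) = !(b' i) := fun i =>
    glue_inr (orSplit κ) u _ (Sum.inr i)
  have h3 : ∀ i, x (Sum.inr (Fintype.equivFin κ i)) = u i := fun i =>
    glue_inl (orSplit κ) u _ i
  have h4 : orPerm Finset.univ x ∘ Sum.inl = Sum.elim b b' := by
    funext q
    rcases q with j | j <;> simp [orPerm, h1, h2]
  -- Traced back, the output `u` comes from ancillas at `0` exactly when it is the disjunction.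
  have h5 : orPerm Finset.univ x ∘ Sum.inr = (fun _ => false) ↔ (fun i => b i || b' i) = u := by
    rw [funext_iff, funext_iff, ← (Fintype.equivFin κ).forall_congr_right]
    refine forall_congr' fun i => ?_
    simp only [orPerm, Function.comp, Sum.elim_inr, Equiv.symm_apply_apply, Finset.mem_univ,
      if_true, h1, h2, h3]
    cases b i <;> cases b' i <;> cases u i <;> simp
  rw [h4]
  exact if_congr ((and_self_iff).trans h5) rfl rfl

end Disjunction

/-! ### The simulator -/

/-- Swap the last two of three registers. -/
def swapLast (a b c : Type) : (a ⊕ b) ⊕ c ≃ (a ⊕ c) ⊕ b :=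
  (Equiv.sumAssoc _ _ _).trans ((Equiv.sumCongr (Equiv.refl _) (Equiv.sumComm _ _)).trans
    (Equiv.sumAssoc _ _ _).symm)

/-- Run the last two stages of an adversary, keeping both rounds of abort bits. -/
noncomputable def Adversary.bothRounds (A : Adversary 𝒢 P) :
    PartyCircuit 𝒢 (Fin A.mem₁ ⊕ P.AdvCode)
      ((P.Corrupted ⊕ P.Corrupted) ⊕ (P.AdvCode ⊕ Fin P.sideOut)) :=
  ((A.second.relabelOut (Equiv.sumComm _ _)).comp A.last).relabelOut (swapLast _ _ _)

/-- The simulator that runs the adversary and aborts if it aborts in one of the two rounds. -/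
noncomputable def Adversary.simulator (A : Adversary 𝒢 P) (hnot : ⟨1, notGate⟩ ∈ 𝒢)
    (htof : ⟨3, toffoliGate⟩ ∈ 𝒢) : Simulator 𝒢 P where
  mem := A.mem₁
  first := A.first
  last := A.bothRounds.comp (orCircuit P.Corrupted hnot htof)

theorem Adversary.simulator_size (A : Adversary 𝒢 P) (hnot : ⟨1, notGate⟩ ∈ 𝒢)
    (htof : ⟨3, toffoliGate⟩ ∈ 𝒢) : (A.simulator hnot htof).size ≤ 8 * A.size := by
  have h1 : (A.simulator hnot htof).last.size ≤
      A.bothRounds.size + (orCircuit P.Corrupted hnot htof).size :=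
    PartyCircuit.comp_size _ _
  have h2 : A.bothRounds.size ≤ A.second.size + A.last.size :=
    PartyCircuit.comp_size (A.second.relabelOut (Equiv.sumComm _ _)) A.last
  -- The abort bits are among the qubits of `A.second`, so the disjunction costs at most `7 *
  -- A.second.size`; this gives the factor `8`.
  have h3 : Fintype.card P.Corrupted ≤ A.second.size := by
    have h := Fintype.card_le_of_embedding (Function.Embedding.inl.trans A.second.out)
    rw [Fintype.card_sum (β := Fin A.second.anc), Fintype.card_fin] at h
    rw [PartyCircuit.size]
    omega
  have h4 : (A.simulator hnot htof).first.size = A.first.size := rfl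
  rw [orCircuit_size] at h1
  rw [Simulator.size, Adversary.size]
  omega

/-- The first-round bits bypass `A.last`, so reading them after it is the same as reading them
before. -/
theorem Adversary.bothRounds_run (A : Adversary 𝒢 P) (ρ : Op (Reg (Fin A.mem₁ ⊕ P.AdvCode)))
    (b b' : P.Corrupted → Bool) (g g' : Reg (P.AdvCode ⊕ Fin P.sideOut)) :
    A.bothRounds.run ρ (Sum.elim (Sum.elim b' b) g) (Sum.elim (Sum.elim b' b) g') =
      A.last.run (Matrix.of fun p q => A.second.run ρ (Sum.elim b p) (Sum.elim b q))
        (Sum.elim b' g) (Sum.elim b' g') := by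
  have hs : ∀ g : Reg (P.AdvCode ⊕ Fin P.sideOut), Sum.elim (Sum.elim b' b) g ∘
      (swapLast P.Corrupted P.Corrupted (P.AdvCode ⊕ Fin P.sideOut)).symm =
      Sum.elim (Sum.elim b' g) b := by
    intro g
    funext q
    rcases q with (q | q) | q <;> rfl
  have hc : ∀ p : Reg (Fin A.mem₂), Sum.elim p b ∘
      (Equiv.sumComm (Fin A.mem₂) P.Corrupted).symm = Sum.elim b p := by
    intro p
    funext q
    rcases q with q | q <;> rfl
  rw [bothRounds, PartyCircuit.relabelOut_run, hs, hs, PartyCircuit.comp_run]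
  simp only [PartyCircuit.relabelOut_run, hc]

/-- Measuring the disjunction and discarding the bits coarse-grains the measurement of both rounds:
the branches with the same disjunction add up. -/
theorem Adversary.simulator_run (A : Adversary 𝒢 P) (hnot : ⟨1, notGate⟩ ∈ 𝒢)
    (htof : ⟨3, toffoliGate⟩ ∈ 𝒢) {d : ℕ}
    (ρ : Op (Reg (Fin A.mem₁ ⊕ P.AdvCode) × (Fin d × Reg P.HonCode))) (u : P.Corrupted → Bool) :
    deliver (measureBits u (onFst (A.simulator hnot htof).last.run ρ)) =
      ∑ b : P.Corrupted → Bool, ∑ b' : P.Corrupted → Bool,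
        if (fun i => b' i || b i) = u then
          deliver (measureBits b' (onFst A.last.run (measureBits b (onFst A.second.run ρ))))
        else 0 := by
  ext x y
  let i : P.EnvOut d → Reg (P.AdvCode ⊕ Fin P.sideOut) := fun q =>
    Sum.elim (fun w => q.2.1 (w.1.1, w.2)) q.2.2
  let h : P.EnvOut d → Fin d × Reg P.HonCode := fun q => (q.1, fun w => q.2.1 (w.1.1, w.2))
  have hl := PartyCircuit.comp_run A.bothRounds (orCircuit P.Corrupted hnot htof)
    (Matrix.of fun p q => ρ (p, h x) (q, h y)) u u (i x) (i y)
  refine hl.trans ?_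
  -- `bothRounds` lists the second-round bits first, hence the exchange of sums.
  rw [orCircuit_run, Finset.sum_comm, Matrix.sum_apply]
  refine Finset.sum_congr rfl fun b _ => ?_
  rw [Matrix.sum_apply]
  refine Finset.sum_congr rfl fun b' _ => ?_
  split_ifs
  · exact A.bothRounds_run _ b b' (i x) (i y)
  · rfl

/-! ### Equality of the two executions -/

theorem afterFunctionality_clifford {d mem : ℕ} (C : Circuit P.W M) (G : cliffordGroup 1)
    (w : P.OutWire) (hw : w.1 ∉ M) (ctrl : Option {l : Fin P.W // l ∈ M})
    (first : PartyCircuit 𝒢 (P.AdvIn ⊕ Fin P.sideIn) (P.AdvIn ⊕ Fin mem))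
    (ρ : Op (P.EnvIn d)) (s : P.Record M) :
    afterFunctionality (C.clifford G w.1 hw ctrl) first ρ (updateKey G w ctrl s) =
      afterFunctionality C first ρ s := by
  have h : functionality (C.clifford G w.1 hw ctrl) (updateKey G w ctrl s) = functionality C s :=
    funext fun σ => functionality_clifford C G w hw ctrl s σ
  simp only [afterFunctionality, h]

/-- Either round can only turn the store into `⊥`, and `⊥` persists. -/
theorem mpcCall_storeUnlessAbort (f : P.Record M → P.Record M) (b b' : P.Corrupted → Bool)
    (s : P.Record M) :
    mpcCall f b' (storeUnlessAbort b s) = storeUnlessAbort (fun i => b' i || b i) (f s) := by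
  simp only [mpcCall, storeUnlessAbort, Bool.or_eq_false_iff, forall_and]
  by_cases h : ∀ i, b i = false
  · by_cases h' : ∀ i, b' i = false
    · rw [if_pos h', if_pos h, if_pos ⟨h', h⟩, Option.map_some]
    · rw [if_neg h', if_neg fun hh => h' hh.1]
  · rw [if_neg h, Option.map_none, ite_self]
    exact (if_neg fun hh => h hh.2).symm

theorem protocolExec_eq_idealExec {d : ℕ} (C : Circuit P.W M) (G : cliffordGroup 1)
    (w : P.OutWire) (hw : w.1 ∉ M) (ctrl : Option {l : Fin P.W // l ∈ M}) (A : Adversary 𝒢 P)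
    (hnot : ⟨1, notGate⟩ ∈ 𝒢) (htof : ⟨3, toffoliGate⟩ ∈ 𝒢) (ρ : Op (P.EnvIn d)) :
    protocolExec C G w ctrl A ρ =
      idealExec (C.clifford G w.1 hw ctrl) (A.simulator hnot htof) ρ := by
  funext t
  rw [protocolExec, idealExec]
  -- Pair the record `s` of the protocol with the updated record in the ideal execution.
  refine Eq.trans ?_ ((updateKey_bijective G w ctrl).sum_comp _)
  refine Finset.sum_congr rfl fun s _ => ?_
  simp only [afterFunctionality_clifford, mpcCall_storeUnlessAbort]
  symm
  have hfirst : afterFunctionality C (A.simulator hnot htof).first ρ s =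
      afterFunctionality C A.first ρ s := rfl
  rw [hfirst]
  set X := afterFunctionality C A.first ρ s
  have hrun := A.simulator_run hnot htof X
  -- For each `(b, b')` exactly one `u`, their disjunction, contributes, so the sum over `u`
  -- collapses.
  calc _ = ∑ u : P.Corrupted → Bool, ∑ b : P.Corrupted → Bool, ∑ b' : P.Corrupted → Bool,
        if (fun i => b' i || b i) = u then
          if storeUnlessAbort u (updateKey G w ctrl s) = t then
            deliver (measureBits b' (onFst A.last.run (measureBits b (onFst A.second.run X))))
          else 0
        else 0 := by
        refine Finset.sum_congr rfl fun u _ => ?_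
        split_ifs
        · exact hrun u
        · simp
    _ = _ := by
        rw [Finset.sum_comm]
        refine Finset.sum_congr rfl fun b _ => ?_
        rw [Finset.sum_comm]
        refine Finset.sum_congr rfl fun b' _ => ?_
        rw [Finset.sum_ite_eq, if_pos (Finset.mem_univ _)]

end MPQC

/-- Composing the ideal functionality for `C` with the subprotocol for a (classically controlled)
single-qubit Clifford `G` perfectly implements the ideal functionality for `C` followed by `G`. -/
theorem mainTheorem11 :
    ∃ p : Polynomial ℕ, ∀ (𝒢 : MPQC.GateSet),
      ⟨1, MPQC.notGate⟩ ∈ 𝒢 → ⟨3, MPQC.toffoliGate⟩ ∈ 𝒢 →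
      ∀ (P : MPQC.Setting) (M : Finset (Fin P.W)) (C : MPQC.Circuit P.W M)
        (G : MPQC.cliffordGroup 1) (w : P.OutWire) (hw : w.1 ∉ M)
        (ctrl : Option {l : Fin P.W // l ∈ M}) (A : MPQC.Adversary 𝒢 P),
        ∃ S : MPQC.Simulator 𝒢 P, S.size ≤ p.eval A.size ∧
          ∀ Z : MPQC.Environment P M,
            Z.acceptProb (MPQC.protocolExec C G w ctrl A Z.state) =
              Z.acceptProb (MPQC.idealExec (C.clifford G w.1 hw ctrl) S Z.state) := by
  refine ⟨8 * Polynomial.X, fun 𝒢 hnot htof P M C G w hw ctrl A =>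
    ⟨A.simulator hnot htof, ?_, fun Z => ?_⟩⟩
  · simpa using A.simulator_size hnot htof
  · rw [MPQC.protocolExec_eq_idealExec C G w hw ctrl A hnot htof]
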